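/- Let $d\ge 1$, let $(n_k)_{k\ge1}$ be integers with $n_k\ge 2$, and for $k\ge 1$, $1\le j\le n_k$ let $T_{k,j}$ be non-singular linear maps of $\mathbb{R}^d$ whose smallest singular values are bounded below by a common positive constant. Let $\Sigma^k$ be the set of words $u_1\cdots u_k$ with $1\le u_i\le n_i$, $\Sigma^*=\bigcup_{k\ge 0}\Sigma^k$, $\Sigma^\infty$ the set of infinite words $u_1u_2\cdots$ with $1\le u_i\le n_i$, $\mathcal C_{\mathbf u}\subset\Sigma^\infty$ the cylinder of infinite words beginning with $\mathbf u$, and $T_{\mathbf u}=T_{1,u_1}\cdots T_{k,u_k}$ for $\mathbf u\in\Sigma^k$. For a linear map $T$ of $\mathbb{R}^d$ with singular values $\alpha_1\ge\dots\ge\alpha_d$ put $\phi^0(T)=1$, $\phi^s(T)=\alpha_1\cdots\alpha_{m-1}\alpha_m^{\,s-m+1}$ for $0<s\le d$, where $m=\lceil s\rceil$, and $\phi^s(T)=(\alpha_1\cdots\alpha_d)^{s/d}$ for $s>d$. Define $$\mathcal M^s(\Sigma^\infty)=\lim_{k\to\infty}\inf\Big\{\sum_{\mathbf u\in A}\phi^s(T_{\mathbf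 u}) : A\subset\Sigma^*,\ |\mathbf u|\ge k \text{ for all } \mathbf u\in A,\ \Sigma^\infty\subset\bigcup_{\mathbf u\in A}\mathcal C_{\mathbf u}\Big\},\qquad s_A=\inf\{s\ge 0:\mathcal M^s(\Sigma^\infty)=0\}.$$ Let $\tau\ge 1$ and to every non-empty word $\mathbf u\in\Sigma^*$ assign an index $\gamma(\mathbf u)\in\{1,\dots,\tau\}$ such that, for each $k\ge1$ and $\mathbf u\in\Sigma^{k-1}$, the indices $\gamma(\mathbf u1),\dots,\gamma(\mathbf un_k)$ are pairwise distinct. For $\mathbf a=(a_1,\dots,a_\tau)\in(\mathbb{R}^d)^\tau=\mathbb{R}^{\tau d}$ let $\Psi_\emptyset=\mathrm{id}$ and $\Psi_{\mathbf uj}(x)=\Psi_{\mathbf u}(T_{k,j}x+a_{\gamma(\mathbf uj)})$ for $\mathbf u\in\Sigma^{k-1}$, $1\le j\le n_k$. Call a compact set $J\subset\mathbb{R}^d$ with non-empty interior admissible for $\mathbf a$ if $\Psi_{\mathbf uj}(J)\subset\Psi_{\mathbf u}(J)$ for all such $\mathbf u,j$ and $\lim_{k\to\infty}\max_{\mathbf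 u\in\Sigma^k}\operatorname{diam}\Psi_{\mathbf u}(J)=0$; the corresponding self-affine Moran set is $E^{\mathbf a}=\bigcap_{k\ge1}\bigcup_{\mathbf u\in\Sigma^k}\Psi_{\mathbf u}(J)$. Suppose that $\sup\{\|T_{k,j}\| : k\ge 1,\ 1\le j\le n_k\}<\tfrac12$ (Euclidean operator norm). Then for $\mathcal L^{\tau d}$-almost all $\mathbf a\in\mathbb{R}^{\tau d}$ an admissible $J$ exists, and for every admissible $J$: (1) $\dim_{\rm H}E^{\mathbf a}=s_A$ if $s_A\le d$; (2) $\mathcal L^d(E^{\mathbf a})>0$ if $s_A>d$. -/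

import Mathlib

open MeasureTheory Filter Topology
open scoped NNReal ENNReal

noncomputable section

/-- Words of length `k`.  Levels are numbered from `0`: the letter in position `i` is one of the
`n i` elements of `Fin (n i)`. -/
abbrev MoranWord (n : ℕ → ℕ) (k : ℕ) : Type := (i : Fin k) → Fin (n i)

/-- Infinite words. -/
abbrev MoranInfWord (n : ℕ → ℕ) : Type := (k : ℕ) → Fin (n k)

namespace MoranWord

variable {n : ℕ → ℕ} {k : ℕ}

/-- The word `u⁻`, i.e. `u` without its last letter. -/
def init (u : MoranWord n (k + 1)) : MoranWord n k := fun i => u i.castSucc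

/-- The last letter of a non-empty word. -/
def last (u : MoranWord n (k + 1)) : Fin (n k) := u (Fin.last k)

/-- The cylinder of the infinite words that begin with `u`. -/
def cylinder (u : MoranWord n k) : Set (MoranInfWord n) := {v | ∀ i : Fin k, v i = u i}

end MoranWord

/-- Singular value function `φ^s` on `ℝ^d`.  Mathlib's singular values are decreasing and indexed
from `0`, so `α_i` is `singularValues (i - 1)`.  For `0 < s ≤ d`, with `m = ⌈s⌉`, it is
`α_1 ⋯ α_{m-1} α_m ^ (s - m + 1)`; for `s > d` it is `(α_1 ⋯ α_d) ^ (s / d)`; and `φ^0 = 1`. -/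
def singularValueFunction {d : ℕ} (s : ℝ≥0)
    (T : EuclideanSpace ℝ (Fin d) →L[ℝ] EuclideanSpace ℝ (Fin d)) : ℝ :=
  if s = 0 then 1
  else if s ≤ d then
    (∏ i ∈ Finset.range (⌈s⌉₊ - 1), T.toLinearMap.singularValues i) *
      T.toLinearMap.singularValues (⌈s⌉₊ - 1) ^ ((s : ℝ) - (⌈s⌉₊ : ℝ) + 1)
  else (∏ i ∈ Finset.range d, T.toLinearMap.singularValues i) ^ ((s : ℝ) / (d : ℝ))

section Moran

variable {d : ℕ} {n : ℕ → ℕ}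
  (T : ∀ k, Fin (n k) → (EuclideanSpace ℝ (Fin d) →L[ℝ] EuclideanSpace ℝ (Fin d)))
  (w : ∀ k, MoranWord n k → Fin (n k) → EuclideanSpace ℝ (Fin d))

/-- The product `T_u` of the linear parts along the word `u`. -/
def moranLinear : (k : ℕ) → MoranWord n k →
    (EuclideanSpace ℝ (Fin d) →L[ℝ] EuclideanSpace ℝ (Fin d))
  | 0, _ => ContinuousLinearMap.id ℝ _
  | k + 1, u => (moranLinear k u.init).comp (T k u.last)

/-- The affine map `Ψ_u`: `Ψ_∅ = id` and `Ψ_{uj}(x) = Ψ_u (T_{k,j} x + ω_{uj})`, where the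
translation `ω_{uj}` is `w k u j`. -/
def moranMap : (k : ℕ) → MoranWord n k → EuclideanSpace ℝ (Fin d) → EuclideanSpace ℝ (Fin d)
  | 0, _ => id
  | k + 1, u => fun x => moranMap k u.init (T k u.last x + w k u.init u.last)

/-- The basic set `J_u = Ψ_u(J)`. -/
def moranBasicSet (J : Set (EuclideanSpace ℝ (Fin d))) (k : ℕ) (u : MoranWord n k) :
    Set (EuclideanSpace ℝ (Fin d)) :=
  moranMap T w k u '' J

/-- The collection `{Ψ_u(J)}` fulfils the self-affine Moran structure. -/
structure IsSelfAffineMoran (J : Set (EuclideanSpace ℝ (Fin d))) : Prop where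
  isCompact : IsCompact J
  interior_nonempty : (interior J).Nonempty
  nested : ∀ (k : ℕ) (u : MoranWord n (k + 1)),
    moranBasicSet T w J (k + 1) u ⊆ moranBasicSet T w J k u.init
  diam_tendsto : Tendsto (fun k => ⨆ u : MoranWord n k, Metric.diam (moranBasicSet T w J k u))
    atTop (𝓝 0)

/-- The self-affine Moran set `E = ⋂_{k ≥ 1} ⋃_{|u| = k} J_u`. -/
def moranSet (J : Set (EuclideanSpace ℝ (Fin d))) : Set (EuclideanSpace ℝ (Fin d)) :=
  ⋂ k : ℕ, ⋃ u : MoranWord n (k + 1), moranBasicSet T w J (k + 1) u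

/-- `M^s_{(k)}(G)`: infimum of `∑ φ^s(T_u)` over the covers of `G` by cylinders of words of length
at least `k`. -/
def netPremeasure (s : ℝ≥0) (k : ℕ) (G : Set (MoranInfWord n)) : ℝ≥0∞ :=
  ⨅ (A : Set (Σ l : ℕ, MoranWord n l)) (_ : ∀ u ∈ A, k ≤ u.1)
    (_ : G ⊆ ⋃ u ∈ A, u.2.cylinder),
    ∑' u : A, ENNReal.ofReal (singularValueFunction s (moranLinear T u.1.1 u.1.2))

/-- `M^s(G)`: the limit of the sequence `M^s_{(k)}(G)`, non-decreasing in `k`, as `k → ∞`. -/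
def netMeasure (s : ℝ≥0) (G : Set (MoranInfWord n)) : ℝ≥0∞ := ⨆ k : ℕ, netPremeasure T s k G

/-- The critical value `s_A = inf {s ≥ 0 : M^s(Σ^∞) = 0}`. -/
def criticalValue : ℝ≥0∞ := ⨅ (s : ℝ≥0) (_ : netMeasure T s Set.univ = 0), (s : ℝ≥0∞)

end Moran

end

/-
Idea. For the upper bound, cover each `Ψ_u(J)` by boxes of side comparable to the singular value
of `T_u` at which `φ^s(T_u)` breaks off; the number of boxes times the `s`-th power of the side is
then comparable to `φ^s(T_u)`.

For the lower bounds, `M^s(Σ^∞) > 0` yields a Frostman measure `μ` on `Σ^∞` whose cylinders have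
mass at most a constant times `φ^s(T_u)`. Two infinite words that first differ after a common
prefix `p` are coded by points whose difference is `T_p` applied to the difference of two distinct
coordinates of `a`, up to a perturbation that is contracting relative to it because
`η / (1 - η) < 1`, where `η < 1 / 2` bounds the norms of the linear parts. Hence the parameters `a`
in a ball for which the points are `r`-close have measure `O(r ^ t / φ^t(T_p))` for `t ≤ d`.
Integrating against `μ ⊗ μ` and applying Fubini bounds the mean over `a` of the correlation
integral of the image of `μ` at scale `r` by `O(r ^ t)` when `t < s`. For almost every `a` this
gives `dim_H E ≥ t` by the mass distribution principle and, if `t = d` is allowed, positive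
Lebesgue measure, since a measure singular to Lebesgue measure has infinite `d`-dimensional
density almost everywhere.
-/

noncomputable section

section SingularValues

variable {E F : Type*} [NormedAddCommGroup E] [InnerProductSpace ℝ E] [FiniteDimensional ℝ E]
  [NormedAddCommGroup F] [InnerProductSpace ℝ F] [FiniteDimensional ℝ F]

theorem exists_orthonormalBasis_norm_sq_eq {d : ℕ} (hd : Module.finrank ℝ E = d) (T : E →L[ℝ] F) :
    ∃ e : OrthonormalBasis (Fin d) ℝ E,
      ∀ x, ‖T x‖ ^ 2 = ∑ i : Fin d, (T.toLinearMap.singularValues i * inner ℝ (e i) x) ^ 2 := by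
  have hsymm := T.toLinearMap.isSymmetric_adjoint_comp_self
  set e := hsymm.eigenvectorBasis hd with he
  refine ⟨e, fun x => ?_⟩
  have hnorm : ‖T x‖ ^ 2 =
      inner ℝ x ((LinearMap.adjoint T.toLinearMap ∘ₗ T.toLinearMap) x) := by
    rw [LinearMap.comp_apply, LinearMap.adjoint_inner_right, ← real_inner_self_eq_norm_sq,
      ContinuousLinearMap.coe_coe]
  rw [hnorm, ← e.sum_inner_mul_inner]
  refine Finset.sum_congr rfl fun i _ => ?_
  have heigen := hsymm.eigenvectorBasis_apply_self_apply hd x i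
  rw [← he, e.repr_apply_apply, e.repr_apply_apply] at heigen
  rw [heigen, real_inner_comm, mul_pow, T.toLinearMap.sq_singularValues_fin hd i,
    RCLike.ofReal_real_eq_id, id_eq]
  ring

theorem singularValues_mul_abs_inner_le {d : ℕ} {T : E →L[ℝ] F}
    {e : OrthonormalBasis (Fin d) ℝ E}
    (he : ∀ x, ‖T x‖ ^ 2 = ∑ i : Fin d, (T.toLinearMap.singularValues i * inner ℝ (e i) x) ^ 2)
    (x : E) (i : Fin d) :
    T.toLinearMap.singularValues i * |inner ℝ (e i) x| ≤ ‖T x‖ := by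
  rw [← abs_of_nonneg (T.toLinearMap.singularValues_nonneg i), ← abs_mul]
  refine abs_le_of_sq_le_sq ?_ (norm_nonneg _)
  rw [he x]
  exact Finset.single_le_sum (f := fun i : Fin d =>
    (T.toLinearMap.singularValues i * inner ℝ (e i) x) ^ 2) (fun _ _ => sq_nonneg _)
    (Finset.mem_univ i)

theorem singularValues_le_opNorm (T : E →L[ℝ] F) (i : ℕ) :
    T.toLinearMap.singularValues i ≤ ‖T‖ := by
  rcases lt_or_ge i (Module.finrank ℝ E) with hi | hi
  · obtain ⟨e, he⟩ := exists_orthonormalBasis_norm_sq_eq rfl T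
    have hbasis := singularValues_mul_abs_inner_le he (e ⟨i, hi⟩) ⟨i, hi⟩
    rw [real_inner_self_eq_norm_sq, e.norm_eq_one, one_pow, abs_one, mul_one] at hbasis
    exact hbasis.trans (T.unit_le_opNorm _ (e.norm_eq_one _).le)
  · rw [T.toLinearMap.singularValues_of_finrank_le hi]
    exact norm_nonneg _

end SingularValues

section SingularValueExponent

/-- The exponent of `α_{i + 1}` when `φ^s` is written as the product of powers of all the
`α_1, …, α_d`: it is `1` for `i + 1 ≤ s`, the fractional remainder for the next index, and `0`
afterwards. -/
def svExponent (s : ℝ) (i : ℕ) : ℝ := max 0 (min 1 (s - i))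

theorem svExponent_nonneg (s : ℝ) (i : ℕ) : 0 ≤ svExponent s i := le_max_left _ _

theorem svExponent_le_one (s : ℝ) (i : ℕ) : svExponent s i ≤ 1 :=
  max_le zero_le_one (min_le_left _ _)

theorem svExponent_mono {s t : ℝ} (h : s ≤ t) (i : ℕ) : svExponent s i ≤ svExponent t i :=
  max_le_max le_rfl (min_le_min le_rfl (sub_le_sub_right h _))

theorem svExponent_of_add_one_le {s : ℝ} {i : ℕ} (h : (i : ℝ) + 1 ≤ s) : svExponent s i = 1 := by
  rw [svExponent, min_eq_left (by linarith), max_eq_right zero_le_one]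

theorem svExponent_of_le {s : ℝ} {i : ℕ} (h : s ≤ i) : svExponent s i = 0 :=
  max_eq_left ((min_le_right _ _).trans (sub_nonpos.2 h))

theorem svExponent_eq_sub {s : ℝ} {i : ℕ} (h₁ : (i : ℝ) ≤ s) (h₂ : s ≤ i + 1) :
    svExponent s i = s - i := by
  rw [svExponent, min_eq_right (by linarith), max_eq_right (by linarith)]

theorem sum_svExponent {s : ℝ} (hs : 0 ≤ s) (d : ℕ) :
    ∑ i ∈ Finset.range d, svExponent s i = min s d := by
  induction d with
  | zero => simp [hs]
  | succ d ih =>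
    rw [Finset.sum_range_succ, ih, Nat.cast_succ]
    rcases le_total s d with h | h
    · rw [min_eq_left h, svExponent_of_le h, min_eq_left (by linarith), add_zero]
    rcases le_total s (d + 1) with h' | h'
    · rw [min_eq_right h, svExponent_eq_sub h h', min_eq_left h', add_sub_cancel]
    · rw [min_eq_right h, svExponent_of_add_one_le h', min_eq_right h']

theorem prod_rpow_svExponent {d : ℕ} {s : ℝ≥0} (hs : s ≤ d) {x : ℝ} (hx : 0 < x) :
    ∏ i ∈ Finset.range d, x ^ svExponent s i = x ^ (s : ℝ) := by
  rw [← Real.rpow_sum_of_pos hx, sum_svExponent s.coe_nonneg, min_eq_left (by exact_mod_cast hs)]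

end SingularValueExponent

theorem exists_nat_lt_le_add_one {s : ℝ≥0} (hs : s ≠ 0) :
    ∃ m : ℕ, ⌈s⌉₊ = m + 1 ∧ (m : ℝ) < s ∧ (s : ℝ) ≤ m + 1 := by
  obtain ⟨m, hm⟩ := Nat.exists_eq_add_one.2 (Nat.ceil_pos.2 (pos_iff_ne_zero.2 hs))
  refine ⟨m, hm, ?_, ?_⟩
  · exact_mod_cast Nat.lt_ceil.1 (hm.ge.trans_lt' m.lt_succ_self)
  · exact_mod_cast hm ▸ Nat.le_ceil s

section SingularValueFunction

variable {d : ℕ} {T : EuclideanSpace ℝ (Fin d) →L[ℝ] EuclideanSpace ℝ (Fin d)} {s t : ℝ≥0}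

theorem singularValues_pos_of_injective (hT : Function.Injective T) {i : ℕ} (hi : i < d) :
    0 < T.toLinearMap.singularValues i :=
  T.toLinearMap.injective_iff_forall_lt_finrank_singularValues_pos.1 hT i (by simpa using hi)

theorem injective_of_singularValues_pos (h : 0 < T.toLinearMap.singularValues (d - 1)) :
    Function.Injective T :=
  T.toLinearMap.injective_iff_forall_lt_finrank_singularValues_pos.2 fun i hi =>
    h.trans_le (T.toLinearMap.singularValues_antitone
      (Nat.le_sub_one_of_lt (by simpa using hi)))

theorem singularValueFunction_zero : singularValueFunction 0 T = 1 := if_pos rfl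

theorem singularValueFunction_eq_prod (hs : s ≤ d) :
    singularValueFunction s T =
      ∏ i ∈ Finset.range d, T.toLinearMap.singularValues i ^ svExponent s i := by
  rcases eq_or_ne s 0 with rfl | h0
  · rw [singularValueFunction_zero, Finset.prod_eq_one]
    intro i _
    rw [svExponent_of_le (by simp), Real.rpow_zero]
  obtain ⟨m, hm, hms, hsm⟩ := exists_nat_lt_le_add_one h0
  have hmd : m + 1 ≤ d := hm ▸ Nat.ceil_le.2 hs
  have hfirst : ∏ i ∈ Finset.range m, T.toLinearMap.singularValues i =
      ∏ i ∈ Finset.range m, T.toLinearMap.singularValues i ^ svExponent s i := by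
    refine Finset.prod_congr rfl fun i hi => ?_
    have him : (i : ℝ) + 1 ≤ m := by exact_mod_cast Finset.mem_range.1 hi
    rw [svExponent_of_add_one_le (him.trans hms.le), Real.rpow_one]
  have hlast : ∀ i ∈ Finset.range d, i ∉ Finset.range (m + 1) →
      T.toLinearMap.singularValues i ^ svExponent s i = 1 := by
    intro i _ hi
    have hmi : (m : ℝ) + 1 ≤ i := by exact_mod_cast not_lt.1 (Finset.mem_range.not.1 hi)
    rw [svExponent_of_le (hsm.trans hmi), Real.rpow_zero]
  rw [singularValueFunction, if_neg h0, if_pos hs, hm, Nat.add_sub_cancel,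
    ← Finset.prod_subset (Finset.range_subset_range.2 hmd) hlast, Finset.prod_range_succ, hfirst,
    svExponent_eq_sub hms.le hsm]
  congr 2
  push_cast
  ring

theorem singularValueFunction_natCast :
    singularValueFunction d T = ∏ i ∈ Finset.range d, T.toLinearMap.singularValues i := by
  rw [singularValueFunction_eq_prod le_rfl]
  refine Finset.prod_congr rfl fun i hi => ?_
  have hid : (i : ℝ) + 1 ≤ d := by exact_mod_cast Finset.mem_range.1 hi
  rw [svExponent_of_add_one_le (by exact_mod_cast hid), Real.rpow_one]

theorem singularValueFunction_of_lt (hs : d < s) :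
    singularValueFunction s T = singularValueFunction d T ^ ((s : ℝ) / d) := by
  rw [singularValueFunction_natCast, singularValueFunction, if_neg (pos_of_gt hs).ne',
    if_neg hs.not_ge]

theorem singularValueFunction_pos (hT : Function.Injective T) : 0 < singularValueFunction s T := by
  have hpos : ∀ {t : ℝ≥0}, t ≤ d → 0 < singularValueFunction t T := fun ht => by
    rw [singularValueFunction_eq_prod ht]
    exact Finset.prod_pos fun i hi => Real.rpow_pos_of_pos
      (singularValues_pos_of_injective hT (Finset.mem_range.1 hi)) _
  rcases le_or_gt s d with hs | hs
  · exact hpos hs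
  · rw [singularValueFunction_of_lt hs]
    exact Real.rpow_pos_of_pos (hpos le_rfl) _

theorem singularValueFunction_le_rpow_mul_of_le (hT : Function.Injective T) (hts : t ≤ s)
    (hs : s ≤ d) :
    singularValueFunction s T ≤ ‖T‖ ^ ((s : ℝ) - t) * singularValueFunction t T := by
  have hσ : ∀ i ∈ Finset.range d, 0 < T.toLinearMap.singularValues i := fun i hi =>
    singularValues_pos_of_injective hT (Finset.mem_range.1 hi)
  rcases eq_or_lt_of_le hts with rfl | hts'
  · simp
  have hd : 0 < d := by exact_mod_cast (pos_of_gt hts').trans_le hs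
  have hnorm : 0 < ‖T‖ := (hσ 0 (Finset.mem_range.2 hd)).trans_le (singularValues_le_opNorm T 0)
  have hsum : (s : ℝ) - t = ∑ i ∈ Finset.range d, (svExponent s i - svExponent t i) := by
    rw [Finset.sum_sub_distrib, sum_svExponent s.coe_nonneg, sum_svExponent t.coe_nonneg,
      min_eq_left (by exact_mod_cast hs), min_eq_left (by exact_mod_cast hts.trans hs)]
  rw [singularValueFunction_eq_prod hs, singularValueFunction_eq_prod (hts.trans hs), hsum,
    Real.rpow_sum_of_pos hnorm, ← Finset.prod_mul_distrib]
  refine Finset.prod_le_prod (fun i hi => (Real.rpow_pos_of_pos (hσ i hi) _).le) fun i hi => ?_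
  have hexp : svExponent t i ≤ svExponent s i := svExponent_mono (by exact_mod_cast hts) i
  calc T.toLinearMap.singularValues i ^ svExponent s i
      = T.toLinearMap.singularValues i ^ (svExponent s i - svExponent t i) *
          T.toLinearMap.singularValues i ^ svExponent t i := by
        rw [← Real.rpow_add (hσ i hi), sub_add_cancel]
    _ ≤ ‖T‖ ^ (svExponent s i - svExponent t i) *
          T.toLinearMap.singularValues i ^ svExponent t i :=
        mul_le_mul_of_nonneg_right (Real.rpow_le_rpow (hσ i hi).le (singularValues_le_opNorm T i)
          (sub_nonneg.2 hexp)) (Real.rpow_nonneg (hσ i hi).le _)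

theorem singularValueFunction_le_rpow_mul (hd : 0 < d) (hT : Function.Injective T) (ht : t ≤ d)
    (hts : t ≤ s) :
    singularValueFunction s T ≤ ‖T‖ ^ ((s : ℝ) - t) * singularValueFunction t T := by
  rcases le_or_gt s d with hs | hs
  · exact singularValueFunction_le_rpow_mul_of_le hT hts hs
  have hφ : singularValueFunction d T ≤ ‖T‖ ^ ((d : ℝ) - t) * singularValueFunction t T :=
    singularValueFunction_le_rpow_mul_of_le hT ht le_rfl
  have hφd : singularValueFunction d T ≤ ‖T‖ ^ (d : ℝ) := by
    simpa [singularValueFunction_zero] using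
      singularValueFunction_le_rpow_mul_of_le hT (zero_le (a := (d : ℝ≥0))) le_rfl
  have hpos : 0 < singularValueFunction d T := singularValueFunction_pos hT
  have hd' : (0 : ℝ) < d := by exact_mod_cast hd
  have hs' : (d : ℝ) < s := by exact_mod_cast hs
  have ht' : (t : ℝ) ≤ d := by exact_mod_cast ht
  calc singularValueFunction s T
      = singularValueFunction d T ^ (((s : ℝ) - d) / d) * singularValueFunction d T := by
        rw [singularValueFunction_of_lt hs, ← Real.rpow_add_one hpos.ne']
        congr 1
        field_simp
        ring
    _ ≤ (‖T‖ ^ (d : ℝ)) ^ (((s : ℝ) - d) / d) *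
          (‖T‖ ^ ((d : ℝ) - t) * singularValueFunction t T) := by
        gcongr
    _ = ‖T‖ ^ ((s : ℝ) - t) * singularValueFunction t T := by
        rw [← Real.rpow_mul (norm_nonneg _), mul_div_cancel₀ _ hd'.ne', ← mul_assoc,
          ← Real.rpow_add_of_nonneg (norm_nonneg _) (sub_nonneg.2 hs'.le) (sub_nonneg.2 ht'),
          sub_add_sub_cancel]

theorem singularValueFunction_le_one (hT : Function.Injective T) (hT1 : ‖T‖ ≤ 1) (hs : s ≤ d) :
    singularValueFunction s T ≤ 1 := by
  have h := singularValueFunction_le_rpow_mul_of_le hT (zero_le (a := s)) hs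
  rw [singularValueFunction_zero, mul_one] at h
  exact h.trans (Real.rpow_le_one (norm_nonneg _) hT1 (by simp))

end SingularValueFunction

section Volume

theorem volume_setOf_forall_inner_mem {ι E : Type*} [Fintype ι] [NormedAddCommGroup E]
    [InnerProductSpace ℝ E] [FiniteDimensional ℝ E] [MeasurableSpace E] [BorelSpace E]
    (e : OrthonormalBasis ι ℝ E) {I : ι → Set ℝ} (hI : ∀ i, MeasurableSet (I i)) :
    volume {x | ∀ i, inner ℝ (e i) x ∈ I i} = ∏ i, volume (I i) := by
  have hset : {x | ∀ i, inner ℝ (e i) x ∈ I i} =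
      e.repr ⁻¹' ((@WithLp.ofLp 2 (ι → ℝ)) ⁻¹' (Set.univ.pi I)) := by
    ext x
    simp [e.repr_apply_apply]
  have hpi : MeasurableSet (Set.univ.pi I) := MeasurableSet.univ_pi hI
  have hofLp := PiLp.volume_preserving_ofLp ι
  rw [hset, e.measurePreserving_repr.measure_preimage (hofLp.measurable hpi).nullMeasurableSet,
    hofLp.measure_preimage hpi.nullMeasurableSet, volume_pi_pi]

theorem volume_Icc_inter_Icc_le {q α R : ℝ} (hq : 0 < q) (hα₀ : 0 ≤ α) (hα₁ : α ≤ 1) (hR : 1 ≤ R)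
    (a : ℝ) :
    volume (Set.Icc (-q) q ∩ Set.Icc (a - R) (a + R)) ≤ ENNReal.ofReal (2 * R * q ^ α) := by
  rcases le_total 1 q with h | h
  · refine (measure_mono Set.inter_subset_right).trans ?_
    rw [Real.volume_Icc]
    refine ENNReal.ofReal_le_ofReal ?_
    nlinarith [Real.one_le_rpow h hα₀]
  · refine (measure_mono Set.inter_subset_left).trans ?_
    rw [Real.volume_Icc]
    refine ENNReal.ofReal_le_ofReal ?_
    have hpow : q ≤ q ^ α := by simpa using Real.rpow_le_rpow_of_exponent_ge hq h hα₁
    nlinarith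

variable {d : ℕ} {T : EuclideanSpace ℝ (Fin d) →L[ℝ] EuclideanSpace ℝ (Fin d)}

theorem volume_norm_le_and_norm_sub_le (hT : Function.Injective T) {t : ℝ≥0} (ht : t ≤ d) {r R : ℝ}
    (hr : 0 < r) (hR : 1 ≤ R) (x₀ : EuclideanSpace ℝ (Fin d)) :
    volume {x | ‖T x‖ ≤ r ∧ ‖x - x₀‖ ≤ R} ≤
      ENNReal.ofReal ((2 * R) ^ d * r ^ (t : ℝ) / singularValueFunction t T) := by
  obtain ⟨e, he⟩ := exists_orthonormalBasis_norm_sq_eq finrank_euclideanSpace_fin T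
  set σ := T.toLinearMap.singularValues
  have hσ : ∀ i : Fin d, 0 < σ i := fun i => singularValues_pos_of_injective hT i.2
  set I : Fin d → Set ℝ := fun i =>
    Set.Icc (-(r / σ i)) (r / σ i) ∩ Set.Icc (inner ℝ (e i) x₀ - R) (inner ℝ (e i) x₀ + R)
  have hsub : {x | ‖T x‖ ≤ r ∧ ‖x - x₀‖ ≤ R} ⊆ {x | ∀ i, inner ℝ (e i) x ∈ I i} := by
    rintro x ⟨hx, hxR⟩ i
    have hσx : |inner ℝ (e i) x| ≤ r / σ i := by
      rw [le_div_iff₀ (hσ i), mul_comm]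
      exact (singularValues_mul_abs_inner_le he x i).trans hx
    have hxx₀ : |inner ℝ (e i) x - inner ℝ (e i) x₀| ≤ R := by
      rw [← inner_sub_right]
      exact (abs_real_inner_le_norm _ _).trans (by rwa [e.norm_eq_one, one_mul])
    exact ⟨abs_le.1 hσx, Set.mem_Icc_iff_abs_le.1 (by rwa [abs_sub_comm])⟩
  have hprod : ∏ i : Fin d, 2 * R * (r / σ i) ^ svExponent t i =
      (2 * R) ^ d * r ^ (t : ℝ) / singularValueFunction t T := by
    rw [singularValueFunction_eq_prod ht, ← prod_rpow_svExponent ht hr,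
      Finset.prod_mul_distrib, mul_div_assoc, ← Finset.prod_div_distrib,
      ← Fin.prod_univ_eq_prod_range
        (fun i => r ^ svExponent t i / T.toLinearMap.singularValues i ^ svExponent t i),
      Finset.prod_const, Finset.card_univ, Fintype.card_fin]
    congr 1
    exact Finset.prod_congr rfl fun i _ => Real.div_rpow hr.le (hσ i).le _
  calc volume {x | ‖T x‖ ≤ r ∧ ‖x - x₀‖ ≤ R}
      ≤ volume {x | ∀ i, inner ℝ (e i) x ∈ I i} := measure_mono hsub
    _ = ∏ i, volume (I i) :=
        volume_setOf_forall_inner_mem e fun i => measurableSet_Icc.inter measurableSet_Icc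
    _ ≤ ∏ i : Fin d, ENNReal.ofReal (2 * R * (r / σ i) ^ svExponent t i) :=
        Finset.prod_le_prod' fun i _ => volume_Icc_inter_Icc_le (div_pos hr (hσ i))
          (svExponent_nonneg _ _) (svExponent_le_one _ _) hR _
    _ = ENNReal.ofReal ((2 * R) ^ d * r ^ (t : ℝ) / singularValueFunction t T) := by
        rw [← hprod, ENNReal.ofReal_prod_of_nonneg fun i _ => mul_nonneg (by linarith)
          (Real.rpow_nonneg (div_pos hr (hσ i)).le _)]

end Volume

section Cover

theorem exists_grid_cover_closedBall {ι E : Type*} [Fintype ι] [NormedAddCommGroup E]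
    [InnerProductSpace ℝ E] (e : OrthonormalBasis ι ℝ E) {w : ι → ℝ} (hw : ∀ i, 0 < w i) {R : ℝ}
    {N : ι → ℕ} (hN : ∀ i, ⌊2 * R / w i⌋₊ < N i) :
    ∃ c : ((i : ι) → Fin (N i)) → Set E, Metric.closedBall 0 R ⊆ ⋃ f, c f ∧
      ∀ f, ∀ x ∈ c f, ∀ y ∈ c f, ∀ i, |inner ℝ (e i) (x - y)| ≤ w i := by
  set q : ι → E → ℝ := fun i x => (inner ℝ (e i) x + R) / w i with hq
  have hball : ∀ x ∈ Metric.closedBall (0 : E) R, ∀ i, 0 ≤ q i x ∧ q i x ≤ 2 * R / w i := by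
    intro x hx i
    have hinner : |inner ℝ (e i) x| ≤ R :=
      (abs_real_inner_le_norm _ _).trans (by simpa [e.norm_eq_one] using hx)
    obtain ⟨hlow, hupp⟩ := abs_le.1 hinner
    exact ⟨div_nonneg (by linarith) (hw i).le, div_le_div_of_nonneg_right (by linarith) (hw i).le⟩
  refine ⟨fun f => {x ∈ Metric.closedBall 0 R | ∀ i, ⌊q i x⌋₊ = f i}, fun x hx => ?_, ?_⟩
  · exact Set.mem_iUnion.2 ⟨fun i => ⟨⌊q i x⌋₊,
      (Nat.floor_le_floor (hball x hx i).2).trans_lt (hN i)⟩, hx, fun i => rfl⟩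
  rintro f x ⟨hx, hxf⟩ y ⟨hy, hyf⟩ i
  have hxfloor := (Nat.floor_eq_iff (hball x hx i).1).1 (hxf i)
  have hyfloor := (Nat.floor_eq_iff (hball y hy i).1).1 (hyf i)
  have hdiff : q i x - q i y = inner ℝ (e i) (x - y) / w i := by
    simp only [hq, inner_sub_right]
    ring
  have hle : |inner ℝ (e i) (x - y) / w i| ≤ 1 := by
    rw [← hdiff, abs_le]
    constructor <;> linarith
  rwa [abs_div, abs_of_pos (hw i), div_le_one (hw i)] at hle

variable {d : ℕ} {T : EuclideanSpace ℝ (Fin d) →L[ℝ] EuclideanSpace ℝ (Fin d)}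

theorem exists_cover_image_closedBall (hT : Function.Injective T) {R : ℝ} (hR : 0 < R) {δ : ℝ}
    (hδ : 0 < δ) :
    ∃ c : ((i : Fin d) → Fin (⌊T.toLinearMap.singularValues i / δ⌋₊ + 1)) →
        Set (EuclideanSpace ℝ (Fin d)),
      T '' Metric.closedBall 0 R ⊆ ⋃ f, c f ∧
        ∀ f, Metric.ediam (c f) ≤ ENNReal.ofReal (2 * R * √d * δ) := by
  obtain ⟨e, he⟩ := exists_orthonormalBasis_norm_sq_eq finrank_euclideanSpace_fin T
  set σ := T.toLinearMap.singularValues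
  have hσ : ∀ i : Fin d, 0 < σ i := fun i => singularValues_pos_of_injective hT i.2
  have hratio : ∀ i : Fin d, 2 * R / (2 * R * δ / σ i) = σ i / δ := fun i => by field_simp
  obtain ⟨c, hcover, hcell⟩ := exists_grid_cover_closedBall e (w := fun i => 2 * R * δ / σ i)
    (fun i => div_pos (by positivity) (hσ i)) (N := fun i => ⌊σ i / δ⌋₊ + 1)
    (fun i => by rw [hratio]; exact Nat.lt_succ_self _)
  refine ⟨fun f => T '' c f, ?_, fun f => Metric.ediam_le ?_⟩
  · rw [← Set.image_iUnion]
    exact Set.image_mono hcover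
  rintro _ ⟨x, hx, rfl⟩ _ ⟨y, hy, rfl⟩
  rw [edist_dist, dist_eq_norm, ← map_sub]
  refine ENNReal.ofReal_le_ofReal (le_of_sq_le_sq ?_ (by positivity))
  have hcoord : ∀ i : Fin d, (σ i * inner ℝ (e i) (x - y)) ^ 2 ≤ (2 * R * δ) ^ 2 := fun i => by
    rw [← sq_abs, abs_mul, abs_of_pos (hσ i)]
    exact pow_le_pow_left₀ (mul_nonneg (hσ i).le (abs_nonneg _))
      ((le_div_iff₀' (hσ i)).1 (hcell f x hx y hy i)) 2
  calc ‖T (x - y)‖ ^ 2 = ∑ i : Fin d, (σ i * inner ℝ (e i) (x - y)) ^ 2 := he _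
    _ ≤ ∑ _i : Fin d, (2 * R * δ) ^ 2 := Finset.sum_le_sum fun i _ => hcoord i
    _ = (2 * R * √d * δ) ^ 2 := by
        rw [Finset.sum_const, Finset.card_univ, Fintype.card_fin, nsmul_eq_mul,
          mul_right_comm (2 * R), mul_pow _ (√d), Real.sq_sqrt (Nat.cast_nonneg d), mul_comm]

theorem card_mul_singularValues_rpow_le (hT : Function.Injective T) {s : ℝ≥0} (hs : s ≤ d) {m : ℕ}
    (hms : (m : ℝ) < s) (hsm : (s : ℝ) ≤ m + 1) :
    (Fintype.card ((i : Fin d) →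
        Fin (⌊T.toLinearMap.singularValues i / T.toLinearMap.singularValues m⌋₊ + 1)) : ℝ) *
      T.toLinearMap.singularValues m ^ (s : ℝ) ≤ 2 ^ d * singularValueFunction s T := by
  set σ := T.toLinearMap.singularValues
  have hmd : m < d := by exact_mod_cast hms.trans_le (NNReal.coe_le_coe.2 hs)
  have hm : 0 < σ m := singularValues_pos_of_injective hT hmd
  have hcard : (Fintype.card ((i : Fin d) → Fin (⌊σ i / σ m⌋₊ + 1)) : ℝ) ≤
      ∏ i ∈ Finset.range d, 2 * max 1 (σ i / σ m) := by
    rw [Fintype.card_pi, Finset.prod_range]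
    push_cast
    refine Finset.prod_le_prod (fun i _ => by positivity) fun i _ => ?_
    rw [Fintype.card_fin, Nat.cast_add_one]
    linarith [Nat.floor_le (div_nonneg (T.toLinearMap.singularValues_nonneg i) hm.le),
      le_max_left 1 (σ i / σ m), le_max_right 1 (σ i / σ m)]
  have hterm : ∀ i : ℕ, max 1 (σ i / σ m) * σ m ^ svExponent s i = σ i ^ svExponent s i := by
    intro i
    rcases lt_trichotomy i m with h | rfl | h
    · have him : (i : ℝ) + 1 ≤ m := by exact_mod_cast h
      rw [svExponent_of_add_one_le (him.trans hms.le), Real.rpow_one, Real.rpow_one,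
        max_eq_right ((one_le_div hm).2 (T.toLinearMap.singularValues_antitone h.le)),
        div_mul_cancel₀ _ hm.ne']
    · rw [div_self hm.ne', max_self, one_mul]
    · have hmi : (m : ℝ) + 1 ≤ i := by exact_mod_cast h
      rw [svExponent_of_le (hsm.trans hmi), Real.rpow_zero, Real.rpow_zero,
        max_eq_left ((div_le_one hm).2 (T.toLinearMap.singularValues_antitone h.le)), mul_one]
  calc _ ≤ (∏ i ∈ Finset.range d, 2 * max 1 (σ i / σ m)) * σ m ^ (s : ℝ) := by gcongr
    _ = 2 ^ d * ∏ i ∈ Finset.range d, max 1 (σ i / σ m) * σ m ^ svExponent s i := by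
        rw [← prod_rpow_svExponent hs hm, Finset.prod_mul_distrib, Finset.prod_mul_distrib,
          Finset.prod_const, Finset.card_range, mul_assoc]
    _ = 2 ^ d * singularValueFunction s T := by
        rw [singularValueFunction_eq_prod hs, Finset.prod_congr rfl fun i _ => hterm i]

theorem exists_cover_image_closedBall_sum_ediam_rpow_le (hT : Function.Injective T) {s : ℝ≥0}
    (h0 : s ≠ 0) (hs : s ≤ d) {R : ℝ} (hR : 0 < R) :
    ∃ (ι : Type) (_ : Fintype ι) (c : ι → Set (EuclideanSpace ℝ (Fin d))),
      T '' Metric.closedBall 0 R ⊆ ⋃ i, c i ∧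
      (∀ i, Metric.ediam (c i) ≤ ENNReal.ofReal (2 * R * √d * ‖T‖)) ∧
      ∑ i, Metric.ediam (c i) ^ (s : ℝ) ≤
        ENNReal.ofReal ((2 * R * √d) ^ (s : ℝ) * 2 ^ d * singularValueFunction s T) := by
  obtain ⟨m, -, hms, hsm⟩ := exists_nat_lt_le_add_one h0
  have hmd : m < d := by exact_mod_cast hms.trans_le (NNReal.coe_le_coe.2 hs)
  have hm := singularValues_pos_of_injective hT hmd
  obtain ⟨c, hcover, hdiam⟩ := exists_cover_image_closedBall hT hR hm
  refine ⟨_, inferInstance, c, hcover, fun i => (hdiam i).trans (ENNReal.ofReal_le_ofReal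
    (mul_le_mul_of_nonneg_left (singularValues_le_opNorm T m) (by positivity))), ?_⟩
  refine (Finset.sum_le_card_nsmul _ _ _ fun i _ =>
    ENNReal.rpow_le_rpow (hdiam i) s.coe_nonneg).trans ?_
  rw [ENNReal.ofReal_rpow_of_nonneg (by positivity) s.coe_nonneg, Finset.card_univ, nsmul_eq_mul,
    ← ENNReal.ofReal_natCast, ← ENNReal.ofReal_mul (Nat.cast_nonneg _),
    Real.mul_rpow (by positivity) hm.le]
  refine ENNReal.ofReal_le_ofReal ?_
  calc _ = (2 * R * √d) ^ (s : ℝ) * ((Fintype.card ((i : Fin d) → Fin (⌊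
          T.toLinearMap.singularValues i / T.toLinearMap.singularValues m⌋₊ + 1)) : ℝ) *
          T.toLinearMap.singularValues m ^ (s : ℝ)) := by ring
    _ ≤ (2 * R * √d) ^ (s : ℝ) * (2 ^ d * singularValueFunction s T) := by
        exact mul_le_mul_of_nonneg_left (card_mul_singularValues_rpow_le hT hs hms hsm)
          (by positivity)
    _ = _ := by ring

end Cover

section Words

variable {n : ℕ → ℕ} {k : ℕ}

/-- The prefix of length `k` of an infinite word. -/
def MoranInfWord.take (u : MoranInfWord n) (k : ℕ) : MoranWord n k := fun i => u i

theorem MoranWord.mem_cylinder_iff (v : MoranWord n k) (u : MoranInfWord n) :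
    u ∈ v.cylinder ↔ u.take k = v :=
  funext_iff.symm

theorem MoranInfWord.continuous_take (k : ℕ) : Continuous (fun u : MoranInfWord n => u.take k) :=
  continuous_pi fun i => continuous_apply (i : ℕ)

theorem MoranInfWord.measurable_take (k : ℕ) : Measurable (fun u : MoranInfWord n => u.take k) :=
  measurable_pi_lambda _ fun i => measurable_pi_apply (i : ℕ)

theorem MoranWord.measurableSet_cylinder (v : MoranWord n k) : MeasurableSet v.cylinder := by
  have hpre : v.cylinder = (fun u : MoranInfWord n => u.take k) ⁻¹' {v} :=
    Set.ext fun u => v.mem_cylinder_iff u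
  exact hpre ▸ MoranInfWord.measurable_take k (measurableSet_singleton v)

theorem MoranInfWord.exists_take_eq (hn : ∀ k, 0 < n k) (v : MoranWord n k) :
    ∃ u : MoranInfWord n, u.take k = v :=
  ⟨fun i => if h : i < k then v ⟨i, h⟩ else ⟨0, hn i⟩, funext fun i => by simp [take]⟩

end Words

section MoranMaps

variable {d : ℕ} {n : ℕ → ℕ}
  {T : ∀ k, Fin (n k) → (EuclideanSpace ℝ (Fin d) →L[ℝ] EuclideanSpace ℝ (Fin d))}
  {w : ∀ k, MoranWord n k → Fin (n k) → EuclideanSpace ℝ (Fin d)}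
  {J : Set (EuclideanSpace ℝ (Fin d))}

theorem moranLinear_injective (hT : ∀ k j, Function.Injective (T k j)) (k : ℕ)
    (u : MoranWord n k) : Function.Injective (moranLinear T k u) := by
  induction k with
  | zero => exact Function.injective_id
  | succ k ih => exact (ih u.init).comp (hT k u.last)

theorem norm_moranLinear_le {η : ℝ≥0} (hη : ∀ k j, ‖T k j‖ ≤ η) (k : ℕ) (u : MoranWord n k) :
    ‖moranLinear T k u‖ ≤ η ^ k := by
  induction k with
  | zero => simpa only [pow_zero] using! ContinuousLinearMap.norm_id_le
  | succ k ih =>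
    rw [pow_succ]
    exact (ContinuousLinearMap.opNorm_comp_le _ _).trans
      (mul_le_mul (ih u.init) (hη k u.last) (norm_nonneg _) (by positivity))

theorem moranMap_eq_add (k : ℕ) (u : MoranWord n k) (x : EuclideanSpace ℝ (Fin d)) :
    moranMap T w k u x = moranMap T w k u 0 + moranLinear T k u x := by
  induction k generalizing x with
  | zero => simp only [moranMap, moranLinear, id_eq, zero_add, ContinuousLinearMap.id_apply]
  | succ k ih =>
    simp only [moranMap, moranLinear, ContinuousLinearMap.comp_apply]
    rw [ih, ih u.init (T k u.last 0 + _)]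
    simp only [map_add, map_zero, zero_add]
    abel

theorem continuous_moranMap (k : ℕ) (u : MoranWord n k) : Continuous (moranMap T w k u) := by
  rw [funext (moranMap_eq_add k u)]
  fun_prop

theorem isCompact_moranBasicSet (hJ : IsCompact J) (k : ℕ) (u : MoranWord n k) :
    IsCompact (moranBasicSet T w J k u) :=
  hJ.image (continuous_moranMap k u)

theorem exists_forall_mem_moranBasicSet (hn : ∀ k, 0 < n k) (hJ : IsSelfAffineMoran T w J)
    {x : EuclideanSpace ℝ (Fin d)} (hx : x ∈ moranSet T w J) :
    ∃ u : MoranInfWord n, ∀ k, x ∈ moranBasicSet T w J k (u.take k) := by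
  let S : ℕ → Set (MoranInfWord n) := fun k =>
    {u | x ∈ moranBasicSet T w J (k + 1) (u.take (k + 1))}
  have hclosed : ∀ k, IsClosed (S k) := fun k =>
    (isClosed_discrete {v | x ∈ moranBasicSet T w J (k + 1) v}).preimage
      (MoranInfWord.continuous_take (k + 1))
  have hnonempty : ∀ k, (S k).Nonempty := fun k => by
    obtain ⟨v, hv⟩ := Set.mem_iUnion.1 (Set.mem_iInter.1 hx k)
    obtain ⟨u, rfl⟩ := MoranInfWord.exists_take_eq hn v
    exact ⟨u, hv⟩
  obtain ⟨u, hu⟩ := IsCompact.nonempty_iInter_of_sequence_nonempty_isCompact_isClosed S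
    (fun k u hu => hJ.nested (k + 1) (u.take (k + 2)) hu) hnonempty (hclosed 0).isCompact hclosed
  have hmem : ∀ k, x ∈ moranBasicSet T w J (k + 1) (u.take (k + 1)) := fun k =>
    Set.mem_iInter.1 hu k
  exact ⟨u, fun | 0 => hJ.nested 0 (u.take 1) (hmem 0) | k + 1 => hmem k⟩

theorem exists_cover_moranBasicSet (hT : ∀ k j, Function.Injective (T k j)) {s : ℝ≥0} (hs : s ≠ 0)
    (hsd : s ≤ d) {R : ℝ} (hR : 0 < R) (hJ : J ⊆ Metric.closedBall 0 R) (k : ℕ)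
    (u : MoranWord n k) :
    ∃ (ι : Type) (_ : Fintype ι) (c : ι → Set (EuclideanSpace ℝ (Fin d))),
      moranBasicSet T w J k u ⊆ ⋃ i, c i ∧
      (∀ i, Metric.ediam (c i) ≤ ENNReal.ofReal (2 * R * √d * ‖moranLinear T k u‖)) ∧
      ∑ i, Metric.ediam (c i) ^ (s : ℝ) ≤ ENNReal.ofReal ((2 * R * √d) ^ (s : ℝ) * 2 ^ d) *
        ENNReal.ofReal (singularValueFunction s (moranLinear T k u)) := by
  obtain ⟨ι, _, c, hcover, hdiam, hsum⟩ :=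
    exists_cover_image_closedBall_sum_ediam_rpow_le (moranLinear_injective hT k u) hs hsd hR
  have hiso : ∀ i, Metric.ediam ((fun y => moranMap T w k u 0 + y) '' c i) = Metric.ediam (c i) :=
    fun i => (isometry_add_left (moranMap T w k u 0)).ediam_image (c i)
  refine ⟨ι, ‹_›, fun i => (fun y => moranMap T w k u 0 + y) '' c i, ?_,
    fun i => (hiso i).trans_le (hdiam i), ?_⟩
  · rintro _ ⟨y, hy, rfl⟩
    obtain ⟨i, hi⟩ := Set.mem_iUnion.1 (hcover (Set.mem_image_of_mem _ (hJ hy)))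
    exact Set.mem_iUnion.2 ⟨i, _, hi, (moranMap_eq_add k u y).symm⟩
  · simp only [hiso]
    rwa [← ENNReal.ofReal_mul (by positivity)]

end MoranMaps

section UpperBound

theorem hausdorffMeasure_eq_zero_of_forall_exists_cover {X : Type*} [EMetricSpace X]
    [MeasurableSpace X] [BorelSpace X] {s : ℝ} {A : Set X}
    (h : ∀ ε : ℝ≥0∞, ε ≠ 0 → ∃ (ι : Type) (_ : Countable ι) (c : ι → Set X), A ⊆ ⋃ i, c i ∧
      (∀ i, Metric.ediam (c i) ≤ ε) ∧ ∑' i, Metric.ediam (c i) ^ s ≤ ε) :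
    μH[s] A = 0 := by
  have hlim := ENNReal.tendsto_inv_nat_nhds_zero
  choose ι hι c hcover hdiam hsum using fun k : ℕ =>
    h (k : ℝ≥0∞)⁻¹ (ENNReal.inv_ne_zero.2 (ENNReal.natCast_ne_top k))
  have hle := Measure.hausdorffMeasure_le_liminf_tsum s A (fun k : ℕ => (k : ℝ≥0∞)⁻¹) hlim c
    (Eventually.of_forall hdiam) (Eventually.of_forall hcover)
  refine le_antisymm (hle.trans ?_) bot_le
  exact (liminf_le_liminf (Eventually.of_forall hsum)).trans hlim.liminf_eq.le

variable {d : ℕ} {n : ℕ → ℕ}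
  {T : ∀ k, Fin (n k) → (EuclideanSpace ℝ (Fin d) →L[ℝ] EuclideanSpace ℝ (Fin d))}
  {w : ∀ k, MoranWord n k → Fin (n k) → EuclideanSpace ℝ (Fin d)}
  {J : Set (EuclideanSpace ℝ (Fin d))}

theorem one_le_netPremeasure_zero_univ (hn : ∀ k, 0 < n k) (k : ℕ) :
    1 ≤ netPremeasure T 0 k Set.univ := by
  refine le_iInf₂ fun A _ => le_iInf fun hcover => ?_
  obtain ⟨u, hu, -⟩ := Set.mem_iUnion₂.1 (hcover (Set.mem_univ fun k => ⟨0, hn k⟩))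
  refine le_trans ?_ (ENNReal.le_tsum (⟨u, hu⟩ : A))
  rw [singularValueFunction_zero, ENNReal.ofReal_one]

theorem exists_cylinder_cover_of_netMeasure_eq_zero {s : ℝ≥0} (hs : netMeasure T s Set.univ = 0)
    (k : ℕ) {ε : ℝ≥0∞} (hε : ε ≠ 0) :
    ∃ A : Set (Σ l : ℕ, MoranWord n l), (∀ u ∈ A, k ≤ u.1) ∧ Set.univ ⊆ ⋃ u ∈ A, u.2.cylinder ∧
      ∑' u : A, ENNReal.ofReal (singularValueFunction s (moranLinear T u.1.1 u.1.2)) < ε := by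
  have hlt : netPremeasure T s k Set.univ < ε := by
    rw [ENNReal.iSup_eq_zero.1 hs k]
    exact pos_iff_ne_zero.2 hε
  simpa only [netPremeasure, iInf_lt_iff, exists_prop] using hlt

theorem hausdorffMeasure_moranSet_eq_zero (hn : ∀ k, 0 < n k)
    (hT : ∀ k j, Function.Injective (T k j)) {η : ℝ≥0} (hη1 : η < 1) (hη : ∀ k j, ‖T k j‖ ≤ η)
    (hJ : IsSelfAffineMoran T w J) {s : ℝ≥0} (hs0 : s ≠ 0) (hsd : s ≤ d)
    (hs : netMeasure T s Set.univ = 0) :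
    μH[s] (moranSet T w J) = 0 := by
  obtain ⟨R, hR, hJR⟩ := hJ.isCompact.isBounded.subset_closedBall_lt 0 0
  set C : ℝ := 2 * R * √d
  set K : ℝ≥0∞ := ENNReal.ofReal (C ^ (s : ℝ) * 2 ^ d)
  refine hausdorffMeasure_eq_zero_of_forall_exists_cover fun ε hε => ?_
  obtain ⟨k, hk⟩ : ∃ k : ℕ, ENNReal.ofReal (C * (η : ℝ) ^ k) ≤ ε := by
    have hpow := tendsto_pow_atTop_nhds_zero_of_lt_one η.coe_nonneg (by exact_mod_cast hη1)
    have hlim := ENNReal.tendsto_ofReal (hpow.const_mul C)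
    rw [mul_zero, ENNReal.ofReal_zero] at hlim
    exact (hlim.eventually_le_const (pos_iff_ne_zero.2 hε)).exists
  obtain ⟨A, hAlen, hAcover, hAsum⟩ := exists_cylinder_cover_of_netMeasure_eq_zero hs k
    (ENNReal.div_pos hε (ENNReal.ofReal_ne_top (r := C ^ (s : ℝ) * 2 ^ d))).ne'
  choose ι _ c hcover hdiam hsum using fun u : A =>
    exists_cover_moranBasicSet (w := w) hT hs0 hsd hR hJR u.1.1 u.1.2
  refine ⟨Σ u : A, ι u, inferInstance, fun p => c p.1 p.2, fun x hx => ?_, fun p => ?_, ?_⟩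
  · obtain ⟨u, hu⟩ := exists_forall_mem_moranBasicSet hn hJ hx
    obtain ⟨v, hv, huv⟩ := Set.mem_iUnion₂.1 (hAcover (Set.mem_univ u))
    have hxv := hu v.1
    rw [(v.2.mem_cylinder_iff u).1 huv] at hxv
    obtain ⟨i, hi⟩ := Set.mem_iUnion.1 (hcover ⟨v, hv⟩ hxv)
    exact Set.mem_iUnion.2 ⟨⟨⟨v, hv⟩, i⟩, hi⟩
  · refine (hdiam p.1 p.2).trans ((ENNReal.ofReal_le_ofReal ?_).trans hk)
    have hnorm : ‖moranLinear T p.1.1.1 p.1.1.2‖ ≤ (η : ℝ) ^ k :=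
      (norm_moranLinear_le hη _ _).trans
        (pow_le_pow_of_le_one η.coe_nonneg (by exact_mod_cast hη1.le) (hAlen _ p.1.2))
    gcongr
  · calc ∑' p : Σ u : A, ι u, Metric.ediam (c p.1 p.2) ^ (s : ℝ)
        = ∑' u : A, ∑ i, Metric.ediam (c u i) ^ (s : ℝ) := by
          rw [ENNReal.tsum_sigma' (f := fun p : Σ u : A, ι u => Metric.ediam (c p.1 p.2) ^ (s : ℝ))]
          exact tsum_congr fun u => tsum_fintype _
      _ ≤ ∑' u : A, K * ENNReal.ofReal (singularValueFunction s (moranLinear T u.1.1 u.1.2)) :=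
          ENNReal.tsum_le_tsum hsum
      _ ≤ K * (ε / K) := by
          rw [ENNReal.tsum_mul_left]
          gcongr
      _ ≤ ε := ENNReal.mul_div_le

theorem dimH_moranSet_le (hn : ∀ k, 0 < n k) (hT : ∀ k j, Function.Injective (T k j)) {η : ℝ≥0}
    (hη1 : η < 1) (hη : ∀ k j, ‖T k j‖ ≤ η) (hJ : IsSelfAffineMoran T w J) :
    dimH (moranSet T w J) ≤ criticalValue T := by
  refine le_iInf₂ fun s hs => ?_
  rcases le_or_gt s d with hsd | hsd
  · have hs0 : s ≠ 0 := by
      rintro rfl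
      have hone := one_le_netPremeasure_zero_univ (T := T) hn 0
      rw [ENNReal.iSup_eq_zero.1 hs 0] at hone
      exact absurd hone (by simp)
    refine dimH_le_of_hausdorffMeasure_ne_top ?_
    rw [hausdorffMeasure_moranSet_eq_zero hn hT hη1 hη hJ hs0 hsd hs]
    exact ENNReal.zero_ne_top
  · calc dimH (moranSet T w J) ≤ dimH (Set.univ : Set (EuclideanSpace ℝ (Fin d))) :=
          dimH_mono (Set.subset_univ _)
      _ = d := by rw [Real.dimH_univ_eq_finrank, finrank_euclideanSpace_fin]
      _ ≤ s := by exact_mod_cast hsd.le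

end UpperBound

section WordTree

variable {n : ℕ → ℕ} {k : ℕ}

namespace MoranWord

/-- The word obtained from `v` by appending the letter `j`. -/
def snoc (v : MoranWord n k) (j : Fin (n k)) : MoranWord n (k + 1) :=
  Fin.snoc (α := fun i => Fin (n i)) v j

theorem init_snoc (v : MoranWord n k) (j : Fin (n k)) : (v.snoc j).init = v :=
  Fin.init_snoc (α := fun i => Fin (n i)) j v

theorem last_snoc (v : MoranWord n k) (j : Fin (n k)) : (v.snoc j).last = j :=
  Fin.snoc_last (α := fun i => Fin (n i)) j v

theorem snoc_init_last (v : MoranWord n (k + 1)) : v.init.snoc v.last = v :=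
  Fin.snoc_init_self (α := fun i => Fin (n i)) v

theorem mem_cylinder_succ_iff (u : MoranWord n (k + 1)) (v : MoranInfWord n) :
    v ∈ u.cylinder ↔ v ∈ u.init.cylinder ∧ v k = u.last :=
  Fin.forall_fin_succ'

end MoranWord

/-- The first `k` letters of the path from the root along which the letter `ω ⟨l, v⟩` follows the
word `v` of length `l`. -/
def treePrefix (ω : (p : Σ k, MoranWord n k) → Fin (n p.1)) : (k : ℕ) → MoranWord n k
  | 0 => default
  | k + 1 => (treePrefix ω k).snoc (ω ⟨k, treePrefix ω k⟩)

/-- The infinite path from the root along which the letter `ω ⟨l, v⟩` follows the word `v`.  It is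
used to transport independent choices of one letter at every node to a random infinite word. -/
def treePath (ω : (p : Σ k, MoranWord n k) → Fin (n p.1)) : MoranInfWord n :=
  fun k => ω ⟨k, treePrefix ω k⟩

theorem take_treePath (ω : (p : Σ k, MoranWord n k) → Fin (n p.1)) (k : ℕ) :
    (treePath ω).take k = treePrefix ω k := by
  induction k with
  | zero => exact Subsingleton.elim _ _
  | succ k ih =>
    rw [treePrefix, ← ih, ← MoranWord.snoc_init_last ((treePath ω).take (k + 1))]
    congr 1
    change ω ⟨k, treePrefix ω k⟩ = ω ⟨k, (treePath ω).take k⟩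
    rw [ih]

theorem measurable_treePrefix (k : ℕ) :
    Measurable fun ω : (p : Σ k, MoranWord n k) → Fin (n p.1) => treePrefix ω k := by
  induction k with
  | zero => exact measurable_const
  | succ k ih =>
    exact (measurable_of_countable fun p : MoranWord n k × (MoranWord n k → Fin (n k)) =>
      p.1.snoc (p.2 p.1)).comp (ih.prodMk (measurable_pi_lambda _ fun v =>
        measurable_pi_apply (⟨k, v⟩ : Σ k, MoranWord n k)))

theorem measurable_treePath :
    Measurable (treePath : ((p : Σ k, MoranWord n k) → Fin (n p.1)) → MoranInfWord n) :=
  measurable_pi_lambda _ fun k =>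
    (measurable_of_countable fun p : MoranWord n k × (MoranWord n k → Fin (n k)) => p.2 p.1).comp
      ((measurable_treePrefix k).prodMk (measurable_pi_lambda _ fun v =>
        measurable_pi_apply (⟨k, v⟩ : Σ k, MoranWord n k)))

theorem treePath_preimage_cylinder_succ (u : MoranWord n (k + 1)) :
    treePath ⁻¹' u.cylinder = treePath ⁻¹' u.init.cylinder ∩
      {ω : (p : Σ k, MoranWord n k) → Fin (n p.1) | ω ⟨k, u.init⟩ ∈ ({u.last} : Set _)} := by
  ext ω
  refine (u.mem_cylinder_succ_iff _).trans (and_congr_right fun h => ?_)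
  rw [MoranWord.mem_cylinder_iff, take_treePath] at h
  rw [treePath, h]
  rfl

end WordTree

section TreeMeasure

theorem pi_inter_eq_pi_insert_update {ι : Type*} [DecidableEq ι] {α : ι → Type*} (S : Finset ι)
    (t : (i : ι) → Set (α i)) {i : ι} (hi : i ∉ S) (a : Set (α i)) :
    Set.pi S t ∩ {ω | ω i ∈ a} = Set.pi (insert i S : Finset ι) (Function.update t i a) := by
  ext ω
  simp only [Set.mem_inter_iff, Set.mem_pi, Finset.mem_coe, Set.mem_ofPred_eq, Finset.mem_insert,
    forall_eq_or_imp, Function.update_self]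
  rw [and_comm]
  refine and_congr_right fun _ => forall₂_congr fun j hj => ?_
  rw [Function.update_of_ne (ne_of_mem_of_not_mem hj hi)]

theorem infinitePi_pi_inter {ι : Type*} {α : ι → Type*} [∀ i, MeasurableSpace (α i)]
    (μ : (i : ι) → Measure (α i)) [∀ i, IsProbabilityMeasure (μ i)] (S : Finset ι)
    {t : (i : ι) → Set (α i)} (ht : ∀ i, MeasurableSet (t i)) {i : ι} (hi : i ∉ S) {a : Set (α i)}
    (ha : MeasurableSet a) :
    Measure.infinitePi μ (Set.pi S t ∩ {ω | ω i ∈ a}) =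
      Measure.infinitePi μ (Set.pi S t) * μ i a := by
  classical
  have hupdate : ∀ j, MeasurableSet (Function.update t i a j) := fun j => by
    rcases eq_or_ne j i with rfl | hj
    · rwa [Function.update_self]
    · rw [Function.update_of_ne hj]
      exact ht j
  rw [pi_inter_eq_pi_insert_update S t hi a, Measure.infinitePi_pi _ fun j _ => hupdate j,
    Measure.infinitePi_pi _ fun j _ => ht j, Finset.prod_insert hi, Function.update_self, mul_comm]
  congr 1
  exact Finset.prod_congr rfl fun j hj => by
    rw [Function.update_of_ne (ne_of_mem_of_not_mem hj hi)]

variable {n : ℕ → ℕ}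

theorem exists_treePath_preimage_cylinder_eq_pi {k : ℕ} (u : MoranWord n k) :
    ∃ (S : Finset (Σ k, MoranWord n k)) (t : (q : Σ k, MoranWord n k) → Set (Fin (n q.1))),
      (∀ q ∈ S, q.1 < k) ∧ treePath ⁻¹' u.cylinder = Set.pi S t := by
  classical
  induction k with
  | zero => exact ⟨∅, fun _ => ∅, by simp, by simp [MoranWord.cylinder]⟩
  | succ k ih =>
    obtain ⟨S, t, hS, ht⟩ := ih u.init
    have hu : (⟨k, u.init⟩ : Σ k, MoranWord n k) ∉ S := fun h => lt_irrefl _ (hS _ h)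
    refine ⟨insert ⟨k, u.init⟩ S, Function.update t ⟨k, u.init⟩ {u.last}, fun q hq => ?_, ?_⟩
    · rcases Finset.mem_insert.1 hq with rfl | hq
      · exact Nat.lt_succ_self k
      · exact (hS q hq).trans (Nat.lt_succ_self k)
    · rw [treePath_preimage_cylinder_succ, ht]
      exact pi_inter_eq_pi_insert_update S t hu {u.last}

theorem exists_measure_cylinder_succ (p : ∀ k, MoranWord n k → Measure (Fin (n k)))
    [∀ k v, IsProbabilityMeasure (p k v)] :
    ∃ μ : Measure (MoranInfWord n), IsProbabilityMeasure μ ∧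
      ∀ k (u : MoranWord n (k + 1)),
        μ u.cylinder = μ u.init.cylinder * p k u.init {u.last} := by
  set P : Measure ((q : Σ k, MoranWord n k) → Fin (n q.1)) :=
    Measure.infinitePi fun q : Σ k, MoranWord n k => p q.1 q.2
  refine ⟨P.map treePath, Measure.isProbabilityMeasure_map measurable_treePath.aemeasurable,
    fun k u => ?_⟩
  obtain ⟨S, t, hS, ht⟩ := exists_treePath_preimage_cylinder_eq_pi u.init
  have hu : (⟨k, u.init⟩ : Σ k, MoranWord n k) ∉ S := fun h => lt_irrefl _ (hS _ h)
  rw [Measure.map_apply measurable_treePath u.measurableSet_cylinder,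
    Measure.map_apply measurable_treePath u.init.measurableSet_cylinder,
    treePath_preimage_cylinder_succ, ht]
  exact infinitePi_pi_inter (fun q : Σ k, MoranWord n k => p q.1 q.2) S
    (fun _ => MeasurableSet.of_discrete) hu (measurableSet_singleton _)

theorem exists_pmf_mul_le {α : Type*} [Fintype α] [Nonempty α] {f : α → ℝ≥0∞}
    (hf : ∀ j, f j ≠ ∞) {a : ℝ≥0∞} (ha : a ≤ ∑ j, f j) : ∃ p : PMF α, ∀ j, a * p j ≤ f j := by
  by_cases h0 : ∑ j, f j = 0
  · have ha0 : a = 0 := le_antisymm (ha.trans h0.le) bot_le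
    exact ⟨PMF.pure (Classical.arbitrary α), fun j => by rw [ha0, zero_mul]; exact zero_le⟩
  · have htop : ∑ j, f j ≠ ∞ := ENNReal.sum_ne_top.2 fun j _ => hf j
    refine ⟨PMF.normalize f (by rwa [tsum_fintype]) (by rwa [tsum_fintype]), fun j => ?_⟩
    calc a * PMF.normalize f _ _ j ≤ (∑ j, f j) * (f j * (∑ j, f j)⁻¹) := by
          rw [PMF.normalize_apply, tsum_fintype]
          gcongr
      _ = f j := by rw [mul_left_comm, ENNReal.mul_inv_cancel h0 htop, mul_one]

theorem exists_measure_cylinder_le (hn : ∀ k, 0 < n k) {g : ∀ k, MoranWord n k → ℝ≥0∞}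
    (hfin : ∀ k u, g k u ≠ ∞) (hg : ∀ k (v : MoranWord n k), g k v ≤ ∑ j, g (k + 1) (v.snoc j)) :
    ∃ μ : Measure (MoranInfWord n), IsProbabilityMeasure μ ∧
      ∀ k (u : MoranWord n k), g 0 default * μ u.cylinder ≤ g k u := by
  have (k : ℕ) : Nonempty (Fin (n k)) := ⟨⟨0, hn k⟩⟩
  choose p hp using fun k (v : MoranWord n k) => exists_pmf_mul_le (fun j => hfin _ _) (hg k v)
  obtain ⟨μ, hμ, hμsucc⟩ := exists_measure_cylinder_succ fun k v => (p k v).toMeasure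
  refine ⟨μ, hμ, fun k u => ?_⟩
  induction k with
  | zero =>
    rw [Subsingleton.elim u default]
    exact mul_le_of_le_one_right' prob_le_one
  | succ k ih =>
    calc g 0 default * μ u.cylinder = g 0 default * μ u.init.cylinder * p k u.init u.last := by
          rw [hμsucc, PMF.toMeasure_apply_singleton _ _ (measurableSet_singleton _), mul_assoc]
      _ ≤ g k u.init * p k u.init u.last := by
          gcongr
          exact ih u.init
      _ ≤ g (k + 1) u := by simpa only [u.snoc_init_last] using hp k u.init u.last

end TreeMeasure

section NetMeasure

variable {d : ℕ} {n : ℕ → ℕ}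
  {T : ∀ k, Fin (n k) → (EuclideanSpace ℝ (Fin d) →L[ℝ] EuclideanSpace ℝ (Fin d))} {s : ℝ≥0}

theorem netPremeasure_mono (k : ℕ) {G H : Set (MoranInfWord n)} (h : G ⊆ H) :
    netPremeasure T s k G ≤ netPremeasure T s k H :=
  le_iInf₂ fun A hA => le_iInf fun hc => iInf₂_le_of_le A hA (iInf_le _ (h.trans hc))

theorem netPremeasure_union_le (k : ℕ) (G H : Set (MoranInfWord n)) :
    netPremeasure T s k (G ∪ H) ≤ netPremeasure T s k G + netPremeasure T s k H := by
  simp only [netPremeasure, ENNReal.iInf_add, ENNReal.add_iInf]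
  refine le_iInf₂ fun B hB => le_iInf fun hBH => le_iInf₂ fun A hA => le_iInf fun hAG => ?_
  refine iInf₂_le_of_le (A ∪ B) (fun u hu => hu.elim (hA u) (hB u)) (iInf_le_of_le ?_ ?_)
  · rw [Set.biUnion_union]
    exact Set.union_subset_union hAG hBH
  · exact ENNReal.tsum_union_le (fun u : Σ l, MoranWord n l =>
      ENNReal.ofReal (singularValueFunction s (moranLinear T u.1 u.2))) A B

theorem netPremeasure_biUnion_le (k : ℕ) {ι : Type*} (S : Finset ι)
    (G : ι → Set (MoranInfWord n)) :
    netPremeasure T s k (⋃ i ∈ S, G i) ≤ ∑ i ∈ S, netPremeasure T s k (G i) := by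
  classical
  induction S using Finset.induction_on with
  | empty => exact iInf₂_le_of_le ∅ (by simp) (iInf_le_of_le (by simp) (by simp))
  | insert i S hi ih =>
    rw [Finset.sum_insert hi, Finset.set_biUnion_insert]
    exact (netPremeasure_union_le k _ _).trans (add_le_add_right ih _)

theorem netPremeasure_cylinder_le {k : ℕ} (u : MoranWord n k) :
    netPremeasure T s 0 u.cylinder ≤
      ENNReal.ofReal (singularValueFunction s (moranLinear T k u)) := by
  refine iInf₂_le_of_le {⟨k, u⟩} (by simp) (iInf_le_of_le (by simp) ?_)
  rw [tsum_singleton (⟨k, u⟩ : Σ k, MoranWord n k)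
    (fun u => ENNReal.ofReal (singularValueFunction s (moranLinear T u.1 u.2)))]

theorem netPremeasure_cylinder_le_sum_snoc (k : ℕ) {l : ℕ} (v : MoranWord n l) :
    netPremeasure T s k v.cylinder ≤ ∑ j, netPremeasure T s k (v.snoc j).cylinder := by
  refine le_trans (netPremeasure_mono k fun x hx => ?_)
    (netPremeasure_biUnion_le k Finset.univ fun j => (v.snoc j).cylinder)
  refine Set.mem_iUnion₂.2 ⟨x l, Finset.mem_univ _, (MoranWord.mem_cylinder_succ_iff _ _).2 ?_⟩
  rw [MoranWord.init_snoc, MoranWord.last_snoc]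
  exact ⟨hx, rfl⟩

theorem exists_pos_le_singularValueFunction_moranLinear (hT : ∀ k j, Function.Injective (T k j))
    (s : ℝ≥0) (k : ℕ) :
    ∃ ε : ℝ≥0∞, 0 < ε ∧ ∀ l < k, ∀ u : MoranWord n l,
      ε ≤ ENNReal.ofReal (singularValueFunction s (moranLinear T l u)) := by
  let φ : (Σ l : Fin k, MoranWord n l) → ℝ≥0∞ := fun q =>
    ENNReal.ofReal (singularValueFunction s (moranLinear T q.1 q.2))
  have hφ : ∀ q, 0 < φ q := fun q =>
    ENNReal.ofReal_pos.2 (singularValueFunction_pos (moranLinear_injective hT _ _))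
  rcases isEmpty_or_nonempty (Σ l : Fin k, MoranWord n l) with h | h
  · exact ⟨1, one_pos, fun l hl u => h.elim ⟨⟨l, hl⟩, u⟩⟩
  · obtain ⟨q, hq⟩ := Finite.exists_min φ
    exact ⟨φ q, hφ q, fun l hl u => hq ⟨⟨l, hl⟩, u⟩⟩

/-- A cover containing a word of length less than `k` costs at least the smallest of the finitely
many corresponding values of `φ^s`, so the restriction on the lengths does not affect positivity. -/
theorem netPremeasure_zero_ne_zero (hT : ∀ k j, Function.Injective (T k j))
    {G : Set (MoranInfWord n)} (hG : netMeasure T s G ≠ 0) : netPremeasure T s 0 G ≠ 0 := by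
  obtain ⟨k, hk⟩ : ∃ k, netPremeasure T s k G ≠ 0 := by
    by_contra! h
    exact hG (ENNReal.iSup_eq_zero.2 h)
  obtain ⟨ε, hε0, hε⟩ := exists_pos_le_singularValueFunction_moranLinear hT s k
  refine ((lt_min hε0 (pos_iff_ne_zero.2 hk)).trans_le ?_).ne'
  refine le_iInf₂ fun A _ => le_iInf fun hc => ?_
  by_cases hA : ∀ u ∈ A, k ≤ u.1
  · exact (min_le_right _ _).trans (iInf₂_le_of_le A hA (iInf_le _ hc))
  · push Not at hA
    obtain ⟨u, hu, huk⟩ := hA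
    exact (min_le_left _ _).trans ((hε u.1 huk u.2).trans
      (ENNReal.le_tsum (f := fun u : A => ENNReal.ofReal
        (singularValueFunction s (moranLinear T u.1.1 u.1.2))) ⟨u, hu⟩))

/-- Frostman's lemma for the net measures. -/
theorem exists_measure_cylinder_le_singularValueFunction (hn : ∀ k, 0 < n k)
    (hT : ∀ k j, Function.Injective (T k j)) (hs : netMeasure T s Set.univ ≠ 0) :
    ∃ (μ : Measure (MoranInfWord n)) (C : ℝ≥0∞), IsProbabilityMeasure μ ∧ C ≠ ∞ ∧
      ∀ k (u : MoranWord n k),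
        μ u.cylinder ≤ C * ENNReal.ofReal (singularValueFunction s (moranLinear T k u)) := by
  have hfin : ∀ k (u : MoranWord n k), netPremeasure T s 0 u.cylinder ≠ ∞ := fun k u =>
    ((netPremeasure_cylinder_le u).trans_lt ENNReal.ofReal_lt_top).ne
  have huniv : (default : MoranWord n 0).cylinder = Set.univ :=
    Set.eq_univ_of_forall fun x i => i.elim0
  obtain ⟨μ, hμ, hle⟩ := exists_measure_cylinder_le hn hfin
    fun k v => netPremeasure_cylinder_le_sum_snoc 0 v
  rw [huniv] at hle
  refine ⟨μ, (netPremeasure T s 0 Set.univ)⁻¹, hμ,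
    ENNReal.inv_ne_top.2 (netPremeasure_zero_ne_zero hT hs), fun k u => ?_⟩
  rw [mul_comm, ← div_eq_mul_inv, ENNReal.le_div_iff_mul_le
    (Or.inl (netPremeasure_zero_ne_zero hT hs)) (Or.inl (huniv ▸ hfin 0 default)), mul_comm]
  exact (hle k u).trans (netPremeasure_cylinder_le u)

end NetMeasure

section OperatorSeries

variable {E : Type*} [NormedAddCommGroup E] [NormedSpace ℝ E] {S : ℕ → E →L[ℝ] E} {c : ℕ → E}
  {η : ℝ≥0} {M : ℝ}

/-- The product `S 0 ∘ ⋯ ∘ S (l - 1)` of the first `l` operators of a sequence. -/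
def opProd (S : ℕ → E →L[ℝ] E) : ℕ → E →L[ℝ] E
  | 0 => ContinuousLinearMap.id ℝ E
  | l + 1 => (S 0).comp (opProd (fun i => S (i + 1)) l)

/-- The series `c 0 + S 0 (c 1) + S 0 (S 1 (c 2)) + ⋯`, that is, the limit at any point of the
compositions of the affine maps `x ↦ S l x + c l`. -/
def opSeries (S : ℕ → E →L[ℝ] E) (c : ℕ → E) : E := ∑' l, opProd S l (c l)

theorem norm_opProd_le (hS : ∀ l, ‖S l‖ ≤ η) (l : ℕ) : ‖opProd S l‖ ≤ η ^ l := by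
  induction l generalizing S with
  | zero => simpa only [pow_zero] using! ContinuousLinearMap.norm_id_le
  | succ l ih =>
    rw [pow_succ']
    exact (ContinuousLinearMap.opNorm_comp_le _ _).trans
      (mul_le_mul (hS 0) (ih fun i => hS (i + 1)) (norm_nonneg _) η.coe_nonneg)

theorem norm_opProd_apply_le (hS : ∀ l, ‖S l‖ ≤ η) (hc : ∀ l, ‖c l‖ ≤ M) (l : ℕ) :
    ‖opProd S l (c l)‖ ≤ η ^ l * M :=
  (opProd S l).le_of_opNorm_le_of_le (norm_opProd_le hS l) (hc l)

theorem hasSum_geometric_mul (hη1 : η < 1) (M : ℝ) :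
    HasSum (fun l : ℕ => (η : ℝ) ^ l * M) ((1 - η : ℝ)⁻¹ * M) :=
  (hasSum_geometric_of_lt_one η.coe_nonneg (NNReal.coe_lt_one.2 hη1)).mul_right M

theorem norm_opSeries_le (hη1 : η < 1) (hS : ∀ l, ‖S l‖ ≤ η) (hc : ∀ l, ‖c l‖ ≤ M) :
    ‖opSeries S c‖ ≤ (1 - η : ℝ)⁻¹ * M :=
  tsum_of_norm_bounded (hasSum_geometric_mul hη1 M) (norm_opProd_apply_le hS hc)

theorem opSeries_smul (S : ℕ → E →L[ℝ] E) (x : ℝ) (c : ℕ → E) :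
    opSeries S (x • c) = x • opSeries S c := by
  simp only [opSeries, Pi.smul_apply, map_smul]
  exact tsum_const_smul'' x

variable [CompleteSpace E]

theorem summable_opProd (hη1 : η < 1) (hS : ∀ l, ‖S l‖ ≤ η) (hc : ∀ l, ‖c l‖ ≤ M) :
    Summable fun l => opProd S l (c l) :=
  Summable.of_norm_bounded (hasSum_geometric_mul hη1 M).summable (norm_opProd_apply_le hS hc)

theorem opSeries_add (hη1 : η < 1) (hS : ∀ l, ‖S l‖ ≤ η) (hc : ∀ l, ‖c l‖ ≤ M) {c' : ℕ → E}
    {M' : ℝ} (hc' : ∀ l, ‖c' l‖ ≤ M') : opSeries S (c + c') = opSeries S c + opSeries S c' := by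
  simp only [opSeries, Pi.add_apply, map_add]
  exact (summable_opProd hη1 hS hc).tsum_add (summable_opProd hη1 hS hc')

theorem opSeries_eq_add (hη1 : η < 1) (hS : ∀ l, ‖S l‖ ≤ η) (hc : ∀ l, ‖c l‖ ≤ M) :
    opSeries S c = c 0 + S 0 (opSeries (fun l => S (l + 1)) fun l => c (l + 1)) := by
  rw [opSeries, (summable_opProd hη1 hS hc).tsum_eq_zero_add, opSeries,
    (S 0).map_tsum (summable_opProd hη1 (fun l => hS (l + 1)) fun l => hc (l + 1))]
  rfl

end OperatorSeries

section CodingMap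

variable {d : ℕ} {n : ℕ → ℕ}
  {T : ∀ k, Fin (n k) → (EuclideanSpace ℝ (Fin d) →L[ℝ] EuclideanSpace ℝ (Fin d))}
  {w : ∀ k, MoranWord n k → Fin (n k) → EuclideanSpace ℝ (Fin d)}
  {J : Set (EuclideanSpace ℝ (Fin d))} {η : ℝ≥0} {M : ℝ}

/-- The point coded by the letters of `u` from position `k` on, read in the coordinates of the
basic set of `u.take k`: `moranMap T w k (u.take k)` sends it to the point coded by `u`. -/
def codingTail (T : ∀ k, Fin (n k) → (EuclideanSpace ℝ (Fin d) →L[ℝ] EuclideanSpace ℝ (Fin d)))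
    (w : ∀ k, MoranWord n k → Fin (n k) → EuclideanSpace ℝ (Fin d)) (k : ℕ) (u : MoranInfWord n) :
    EuclideanSpace ℝ (Fin d) :=
  opSeries (fun l => T (k + l) (u (k + l))) fun l => w (k + l) (u.take (k + l)) (u (k + l))

/-- The point of the Moran set coded by an infinite word. -/
def codingMap (T : ∀ k, Fin (n k) → (EuclideanSpace ℝ (Fin d) →L[ℝ] EuclideanSpace ℝ (Fin d)))
    (w : ∀ k, MoranWord n k → Fin (n k) → EuclideanSpace ℝ (Fin d)) (u : MoranInfWord n) :
    EuclideanSpace ℝ (Fin d) :=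
  codingTail T w 0 u

theorem norm_codingTail_le (hη1 : η < 1) (hη : ∀ k j, ‖T k j‖ ≤ η) (hw : ∀ k u j, ‖w k u j‖ ≤ M)
    (k : ℕ) (u : MoranInfWord n) : ‖codingTail T w k u‖ ≤ (1 - η : ℝ)⁻¹ * M :=
  norm_opSeries_le hη1 (fun _ => hη _ _) fun _ => hw _ _ _

theorem codingTail_eq_add (hη1 : η < 1) (hη : ∀ k j, ‖T k j‖ ≤ η) (hw : ∀ k u j, ‖w k u j‖ ≤ M)
    (k : ℕ) (u : MoranInfWord n) :
    codingTail T w k u = w k (u.take k) (u k) + T k (u k) (codingTail T w (k + 1) u) := by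
  have hshift : ∀ l, k + (l + 1) = k + 1 + l := fun l => by rw [Nat.add_assoc, Nat.add_comm l]
  have hS : (fun l => T (k + (l + 1)) (u (k + (l + 1)))) = fun l => T (k + 1 + l) (u (k + 1 + l)) :=
    funext fun l => congrArg (fun i => T i (u i)) (hshift l)
  have hc : (fun l => w (k + (l + 1)) (u.take (k + (l + 1))) (u (k + (l + 1)))) =
      fun l => w (k + 1 + l) (u.take (k + 1 + l)) (u (k + 1 + l)) :=
    funext fun l => congrArg (fun i => w i (u.take i) (u i)) (hshift l)
  rw [codingTail, opSeries_eq_add hη1 (fun _ => hη _ _) fun _ => hw _ _ _, hS, hc]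
  rfl

theorem norm_codingTail_sub_le (hη1 : η < 1) (hη : ∀ k j, ‖T k j‖ ≤ η)
    (hw : ∀ k u j, ‖w k u j‖ ≤ M) (k : ℕ) (u : MoranInfWord n) :
    ‖codingTail T w k u - w k (u.take k) (u k)‖ ≤ η * ((1 - η : ℝ)⁻¹ * M) := by
  rw [codingTail_eq_add hη1 hη hw, add_sub_cancel_left]
  exact (T k (u k)).le_of_opNorm_le_of_le (hη _ _) (norm_codingTail_le hη1 hη hw _ _)

theorem moranMap_codingTail (hη1 : η < 1) (hη : ∀ k j, ‖T k j‖ ≤ η)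
    (hw : ∀ k u j, ‖w k u j‖ ≤ M) (k : ℕ) (u : MoranInfWord n) :
    moranMap T w k (u.take k) (codingTail T w k u) = codingMap T w u := by
  induction k with
  | zero => rfl
  | succ k ih =>
    rw [← ih, codingTail_eq_add hη1 hη hw k, add_comm (w k _ _)]
    rfl

theorem codingMap_sub_codingMap (hη1 : η < 1) (hη : ∀ k j, ‖T k j‖ ≤ η)
    (hw : ∀ k u j, ‖w k u j‖ ≤ M) {k : ℕ} {u v : MoranInfWord n} (huv : u.take k = v.take k) :
    codingMap T w u - codingMap T w v =
      moranLinear T k (u.take k) (codingTail T w k u - codingTail T w k v) := by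
  rw [← moranMap_codingTail hη1 hη hw k u, ← moranMap_codingTail hη1 hη hw k v, ← huv,
    moranMap_eq_add, moranMap_eq_add k _ (codingTail T w k v), add_sub_add_left_eq_sub, map_sub]

theorem tendsto_moranMap_take (hη1 : η < 1) (hη : ∀ k j, ‖T k j‖ ≤ η)
    (hw : ∀ k u j, ‖w k u j‖ ≤ M) (u : MoranInfWord n) (x : EuclideanSpace ℝ (Fin d)) :
    Tendsto (fun k => moranMap T w k (u.take k) x) atTop (𝓝 (codingMap T w u)) := by
  have hdist : ∀ k, dist (moranMap T w k (u.take k) x) (codingMap T w u) ≤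
      η ^ k * (‖x‖ + (1 - η : ℝ)⁻¹ * M) := fun k => by
    rw [← moranMap_codingTail hη1 hη hw k u, moranMap_eq_add,
      moranMap_eq_add k _ (codingTail T w k u), dist_add_left, dist_eq_norm, ← map_sub]
    exact (moranLinear T k _).le_of_opNorm_le_of_le (norm_moranLinear_le hη k _)
      ((norm_sub_le _ _).trans (by gcongr; exact norm_codingTail_le hη1 hη hw k u))
  refine tendsto_iff_dist_tendsto_zero.2 (squeeze_zero (fun _ => dist_nonneg) hdist ?_)
  simpa only [zero_mul] using
    (tendsto_pow_atTop_nhds_zero_of_lt_one η.coe_nonneg hη1).mul_const (‖x‖ + (1 - η : ℝ)⁻¹ * M)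

theorem codingMap_mem_moranSet (hη1 : η < 1) (hη : ∀ k j, ‖T k j‖ ≤ η)
    (hw : ∀ k u j, ‖w k u j‖ ≤ M) (hJ : IsSelfAffineMoran T w J) (u : MoranInfWord n) :
    codingMap T w u ∈ moranSet T w J := by
  obtain ⟨x, hx⟩ := hJ.interior_nonempty.mono interior_subset
  refine Set.mem_iInter.2 fun k => Set.mem_iUnion.2 ⟨u.take (k + 1), ?_⟩
  have hanti : Antitone fun k => moranBasicSet T w J k (u.take k) :=
    antitone_nat_of_succ_le fun k => hJ.nested k (u.take (k + 1))
  refine (isCompact_moranBasicSet hJ.isCompact (k + 1) _).isClosed.mem_of_tendsto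
    (tendsto_moranMap_take hη1 hη hw u x) ?_
  filter_upwards [eventually_ge_atTop (k + 1)] with m hm
  exact hanti hm (Set.mem_image_of_mem _ hx)

theorem diam_moranBasicSet_le (hη : ∀ k j, ‖T k j‖ ≤ η) (hJ : Bornology.IsBounded J) (k : ℕ)
    (u : MoranWord n k) : Metric.diam (moranBasicSet T w J k u) ≤ η ^ k * Metric.diam J := by
  refine Metric.diam_le_of_forall_dist_le (by positivity) ?_
  rintro _ ⟨x, hx, rfl⟩ _ ⟨y, hy, rfl⟩
  rw [moranMap_eq_add k u x, moranMap_eq_add k u y, dist_add_left, dist_eq_norm, ← map_sub]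
  refine (moranLinear T k u).le_of_opNorm_le_of_le (norm_moranLinear_le hη k u) ?_
  rw [← dist_eq_norm]
  exact Metric.dist_le_diam_of_mem hJ hx hy

theorem exists_isSelfAffineMoran (hη1 : η < 1) (hη : ∀ k j, ‖T k j‖ ≤ η) (hM : 0 ≤ M)
    (hw : ∀ k u j, ‖w k u j‖ ≤ M) : ∃ J, IsSelfAffineMoran T w J := by
  have hη' : (0 : ℝ) < 1 - η := sub_pos.2 hη1
  set R : ℝ := (M + 1) / (1 - η)
  have hR0 : 0 < R := by positivity
  have hRM : η * R + M ≤ R := by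
    have : R * (1 - η) = M + 1 := div_mul_cancel₀ _ hη'.ne'
    linarith
  refine ⟨Metric.closedBall 0 R, isCompact_closedBall 0 R,
    ⟨0, Metric.ball_subset_interior_closedBall (Metric.mem_ball_self hR0)⟩, ?_, ?_⟩
  · rintro k u _ ⟨x, hx, rfl⟩
    refine ⟨T k u.last x + w k u.init u.last, ?_, rfl⟩
    rw [mem_closedBall_zero_iff] at hx ⊢
    exact (norm_add_le _ _).trans ((add_le_add
      ((T k u.last).le_of_opNorm_le_of_le (hη _ _) hx) (hw _ _ _)).trans hRM)
  · refine squeeze_zero (fun k => Real.iSup_nonneg fun u => Metric.diam_nonneg)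
      (fun k => Real.iSup_le (diam_moranBasicSet_le hη Metric.isBounded_closedBall k)
        (by positivity)) ?_
    simpa only [zero_mul] using (tendsto_pow_atTop_nhds_zero_of_lt_one η.coe_nonneg hη1).mul_const _

end CodingMap

section Averaging

theorem measure_mul_measure_le_of_translates {E V : Type*} [MeasurableSpace E] [MeasurableSpace V]
    [AddGroup V] [MeasurableAdd₂ V] {ν : Measure E} [SFinite ν] {μ : Measure V} [SFinite μ]
    [μ.IsAddRightInvariant] {ι : E → V} (hι : Measurable ι) {B : Set E} {S D : Set V}
    (hS : MeasurableSet S) (hD : MeasurableSet D) {K : ℝ≥0∞}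
    (hK : ∀ a, ν ({y | a + ι y ∈ S} ∩ B) ≤ K) (hSD : ∀ a, ∀ y ∈ B, a + ι y ∈ S → a ∈ D) :
    ν B * μ S ≤ K * μ D := by
  set Q : Set (E × V) := {p | p.2 + ι p.1 ∈ S}
  have hQ : MeasurableSet Q := (measurable_snd.add (hι.comp measurable_fst)) hS
  have hsection : ∀ y, μ (Prod.mk y ⁻¹' Q) = μ S := fun y => measure_preimage_add_right μ (ι y) S
  calc ν B * μ S = ((ν.restrict B).prod μ) Q := by
        rw [Measure.prod_apply hQ]
        simp only [hsection, setLIntegral_const, mul_comm]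
    _ = ∫⁻ a, ν ({y | a + ι y ∈ S} ∩ B) ∂μ := by
        rw [Measure.prod_apply_symm hQ]
        exact lintegral_congr fun a => Measure.restrict_apply (measurable_prodMk_right hQ)
    _ ≤ ∫⁻ a, D.indicator (fun _ => K) a ∂μ := by
        refine lintegral_mono fun a => ?_
        by_cases ha : a ∈ D
        · rw [Set.indicator_of_mem ha]
          exact hK a
        · have hempty : {y | a + ι y ∈ S} ∩ B = ∅ :=
            Set.eq_empty_of_forall_notMem fun y hy => ha (hSD a y hy.2 hy.1)
          rw [hempty, measure_empty]
          exact zero_le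
    _ = K * μ D := lintegral_indicator_const hD K

theorem measure_preimage_le_of_antilipschitzWith {E : Type*} [NormedAddCommGroup E]
    [NormedSpace ℝ E] [FiniteDimensional ℝ E] [MeasurableSpace E] [BorelSpace E] (μ : Measure E)
    [μ.IsAddHaarMeasure] {f : E → E} {K : ℝ≥0} (hf : AntilipschitzWith K f) (s : Set E) :
    μ (f ⁻¹' s) ≤ (K : ℝ≥0∞) ^ Module.finrank ℝ E * μ s := by
  rw [Measure.isAddLeftInvariant_eq_smul μ μH[Module.finrank ℝ E], Measure.smul_apply,
    Measure.smul_apply, ENNReal.smul_def, ENNReal.smul_def, smul_eq_mul, smul_eq_mul,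
    mul_left_comm, ← ENNReal.rpow_natCast]
  exact mul_le_mul_right (hf.hausdorffMeasure_preimage_le (Nat.cast_nonneg _) s) _

theorem antilipschitzWith_of_norm_sub_id_le {E : Type*} [NormedAddCommGroup E] [NormedSpace ℝ E]
    {A : E →L[ℝ] E} {δ : ℝ≥0} (hδ : δ < 1) (hA : ‖A - ContinuousLinearMap.id ℝ E‖ ≤ δ) :
    AntilipschitzWith (1 - δ)⁻¹ A := by
  refine A.antilipschitz_of_bound fun x => ?_
  have hx : ‖A x - x‖ ≤ δ * ‖x‖ := (A - ContinuousLinearMap.id ℝ E).le_of_opNorm_le hA x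
  have hAx : ‖x‖ - ‖A x‖ ≤ ‖A x - x‖ := norm_sub_rev x (A x) ▸ norm_sub_norm_le x (A x)
  rw [NNReal.coe_inv, NNReal.coe_sub hδ.le, NNReal.coe_one, inv_mul_eq_div,
    le_div_iff₀ (sub_pos.2 (NNReal.coe_lt_one.2 hδ))]
  linarith

end Averaging

section Transversality

variable {d : ℕ}

/- Translating `a` along `ι y` moves `G a` by almost `y`, so among the translates of any `a` with
`‖y‖ ≤ 1` those with `L (G (a + ι y))` near `0` form a small set; average over `a`. -/
theorem volume_mul_measure_norm_comp_le_le {V : Type*} [NormedAddCommGroup V] [NormedSpace ℝ V]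
    [SecondCountableTopology V] [MeasurableSpace V] [BorelSpace V] (μ : Measure V) [SFinite μ]
    [μ.IsAddRightInvariant] {G : V →L[ℝ] EuclideanSpace ℝ (Fin d)}
    {ι : EuclideanSpace ℝ (Fin d) →L[ℝ] V} (hι : ‖ι‖ ≤ 1) {δ : ℝ≥0} (hδ : δ < 1)
    (hG : ‖G.comp ι - ContinuousLinearMap.id ℝ _‖ ≤ δ)
    {L : EuclideanSpace ℝ (Fin d) →L[ℝ] EuclideanSpace ℝ (Fin d)} (hL : Function.Injective L)
    {t : ℝ≥0} (ht : t ≤ d) {r : ℝ} (hr : 0 < r) (ρ : ℝ) :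
    volume (Metric.closedBall (0 : EuclideanSpace ℝ (Fin d)) 1) *
        μ (Metric.closedBall 0 ρ ∩ {a | ‖L (G a)‖ ≤ r}) ≤
      ((1 - δ)⁻¹ : ℝ≥0) ^ d *
          ENNReal.ofReal ((2 * 2) ^ d * r ^ (t : ℝ) / singularValueFunction t L) *
        μ (Metric.closedBall 0 (ρ + 1)) := by
  have hclosed : IsClosed (Metric.closedBall 0 ρ ∩ {a | ‖L (G a)‖ ≤ r}) :=
    Metric.isClosed_closedBall.inter (isClosed_le (by fun_prop) continuous_const)
  refine measure_mul_measure_le_of_translates ι.continuous.measurable hclosed.measurableSet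
    Metric.isClosed_closedBall.measurableSet (fun a => ?_) fun a y hy hay => ?_
  · have hanti : AntilipschitzWith (1 - δ)⁻¹ fun y => G (a + ι y) := fun y z => by
      simpa only [map_add, edist_add_left] using! antilipschitzWith_of_norm_sub_id_le hδ hG y z
    have hsub : {y | a + ι y ∈ Metric.closedBall 0 ρ ∩ {a | ‖L (G a)‖ ≤ r}} ∩
        Metric.closedBall 0 1 ⊆ (fun y => G (a + ι y)) ⁻¹' {x | ‖L x‖ ≤ r ∧ ‖x - G a‖ ≤ 2} := by
      rintro y ⟨⟨-, hLG⟩, hy⟩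
      have hy1 : ‖y‖ ≤ 1 := mem_closedBall_zero_iff.1 hy
      have hGy : ‖G (ι y) - y‖ ≤ 1 :=
        ((G.comp ι - ContinuousLinearMap.id ℝ _).le_of_opNorm_le_of_le hG hy1).trans
          (by simpa only [mul_one] using NNReal.coe_le_one.2 hδ.le)
      refine ⟨hLG, ?_⟩
      simp only [map_add, add_sub_cancel_left]
      linarith [norm_le_norm_add_norm_sub' (G (ι y)) y]
    refine (measure_mono hsub).trans ((measure_preimage_le_of_antilipschitzWith volume hanti
      _).trans ?_)
    rw [finrank_euclideanSpace_fin]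
    gcongr
    exact volume_norm_le_and_norm_sub_le hL ht hr one_le_two (G a)
  · rw [mem_closedBall_zero_iff] at hy ⊢
    calc ‖a‖ = ‖(a + ι y) - ι y‖ := by rw [add_sub_cancel_right]
      _ ≤ ‖a + ι y‖ + ‖ι y‖ := norm_sub_le _ _
      _ ≤ ρ + 1 := add_le_add (mem_closedBall_zero_iff.1 hay.1)
          ((ι.le_of_opNorm_le_of_le hι hy).trans_eq (one_mul 1))

variable {n : ℕ → ℕ}
  {T : ∀ k, Fin (n k) → (EuclideanSpace ℝ (Fin d) →L[ℝ] EuclideanSpace ℝ (Fin d))}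
  {η : ℝ≥0} {τ : ℕ} {γ : ∀ k, MoranWord n k → Fin (n k) → Fin τ}

/-- The translations of the Moran maps when the letter `j` after the word `u` uses the vector of
`a` with index `γ k u j`. -/
abbrev translations (γ : ∀ k, MoranWord n k → Fin (n k) → Fin τ)
    (a : Fin τ → EuclideanSpace ℝ (Fin d)) :
    ∀ k, MoranWord n k → Fin (n k) → EuclideanSpace ℝ (Fin d) :=
  fun k u j => a (γ k u j)

theorem isLinearMap_codingTail_translations (hη1 : η < 1) (hη : ∀ k j, ‖T k j‖ ≤ η)
    (γ : ∀ k, MoranWord n k → Fin (n k) → Fin τ) (k : ℕ) (u : MoranInfWord n) :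
    IsLinearMap ℝ fun a => codingTail T (translations γ a) k u where
  map_add a b := opSeries_add hη1 (fun _ => hη _ _) (fun _ => norm_le_pi_norm a _)
    fun _ => norm_le_pi_norm b _
  map_smul x _ := opSeries_smul _ x _

theorem measurable_codingMap (hη1 : η < 1) (hη : ∀ k j, ‖T k j‖ ≤ η) :
    Measurable (Function.uncurry fun a : Fin τ → EuclideanSpace ℝ (Fin d) =>
      codingMap T (translations γ a)) := by
  have hmap : ∀ k (v : MoranWord n k),
      Measurable fun q : (Fin τ → EuclideanSpace ℝ (Fin d)) × EuclideanSpace ℝ (Fin d) =>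
        moranMap T (translations γ q.1) k v q.2 := by
    intro k
    induction k with
    | zero => exact fun _ => measurable_snd
    | succ k ih =>
      exact fun v => (ih v.init).comp (measurable_fst.prodMk
        (((T k v.last).measurable.comp measurable_snd).add
          ((measurable_pi_apply (γ k v.init v.last)).comp measurable_fst)))
  refine measurable_of_tendsto_metrizable (f := fun k p =>
    moranMap T (translations γ p.1) k (p.2.take k) 0) (fun k => ?_) (tendsto_pi_nhds.2 fun p =>
      tendsto_moranMap_take hη1 hη (fun _ _ _ => norm_le_pi_norm p.1 _) p.2 0)
  have hword : Measurable fun q : (Fin τ → EuclideanSpace ℝ (Fin d)) × MoranWord n k =>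
      moranMap T (translations γ q.1) k q.2 0 :=
    measurable_from_prod_countable_left fun v =>
      (hmap k v).comp (measurable_id.prodMk measurable_const)
  exact hword.comp (measurable_fst.prodMk ((MoranInfWord.measurable_take k).comp measurable_snd))

theorem exists_continuousLinearMap_codingTail_sub (hη1 : η < 1) (hη : ∀ k j, ‖T k j‖ ≤ η)
    (γ : ∀ k, MoranWord n k → Fin (n k) → Fin τ) (k : ℕ) (u v : MoranInfWord n) :
    ∃ G : (Fin τ → EuclideanSpace ℝ (Fin d)) →L[ℝ] EuclideanSpace ℝ (Fin d),
      (∀ a, G a = codingTail T (translations γ a) k u - codingTail T (translations γ a) k v) ∧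
      ∀ a, ‖G a - (a (γ k (u.take k) (u k)) - a (γ k (v.take k) (v k)))‖ ≤
        2 * (η * ((1 - η : ℝ)⁻¹ * ‖a‖)) := by
  refine ⟨LinearMap.toContinuousLinearMap
    ((isLinearMap_codingTail_translations hη1 hη γ k u).mk' _ -
      (isLinearMap_codingTail_translations hη1 hη γ k v).mk' _), fun a => rfl, fun a => ?_⟩
  have hnear : ∀ u : MoranInfWord n, ‖codingTail T (translations γ a) k u -
      a (γ k (u.take k) (u k))‖ ≤ η * ((1 - η : ℝ)⁻¹ * ‖a‖) := fun u =>
    norm_codingTail_sub_le hη1 hη (fun _ _ _ => norm_le_pi_norm a _) k u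
  calc _ = ‖(codingTail T (translations γ a) k u - a (γ k (u.take k) (u k))) -
        (codingTail T (translations γ a) k v - a (γ k (v.take k) (v k)))‖ := by
        rw [sub_sub_sub_comm]
        rfl
    _ ≤ _ := (norm_sub_le_of_le (hnear u) (hnear v)).trans_eq (two_mul _).symm

theorem exists_continuousLinearMap_apply_sub_apply {κ E : Type*} [Fintype κ]
    [NormedAddCommGroup E] [NormedSpace ℝ E] {p q : κ} (hpq : p ≠ q) :
    ∃ ι : E →L[ℝ] κ → E, ‖ι‖ ≤ 2⁻¹ ∧ ∀ y, ι y p - ι y q = y := by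
  classical
  set ε : κ → ℝ := fun i => if i = p then 2⁻¹ else if i = q then -2⁻¹ else 0 with hε
  refine ⟨ContinuousLinearMap.pi fun i => ε i • ContinuousLinearMap.id ℝ E, ?_, fun y => ?_⟩
  · refine ContinuousLinearMap.opNorm_le_bound _ (by norm_num) fun y =>
      (pi_norm_le_iff_of_nonneg (by positivity)).2 fun i => ?_
    rw [ContinuousLinearMap.pi_apply, smul_apply, norm_smul]
    refine mul_le_mul_of_nonneg_right ?_ (norm_nonneg y)
    simp only [hε]
    split_ifs <;> norm_num
  · simp only [hε, ContinuousLinearMap.pi_apply, smul_apply,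
      ContinuousLinearMap.id_apply, if_true, if_neg hpq.symm, ← sub_smul]
    norm_num

theorem volume_norm_codingMap_sub_le (hη2 : η < 2⁻¹) (hη : ∀ k j, ‖T k j‖ ≤ η)
    (hT : ∀ k j, Function.Injective (T k j)) (hγ : ∀ k u, Function.Injective (γ k u)) {t : ℝ≥0}
    (ht : t ≤ d) {r : ℝ} (hr : 0 < r) (ρ : ℝ) {k : ℕ} {u v : MoranInfWord n}
    (huv : u.take k = v.take k) (hne : u k ≠ v k) :
    volume (Metric.closedBall (0 : EuclideanSpace ℝ (Fin d)) 1) *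
        volume (Metric.closedBall (0 : Fin τ → EuclideanSpace ℝ (Fin d)) ρ ∩
          {a | ‖codingMap T (translations γ a) u - codingMap T (translations γ a) v‖ ≤ r}) ≤
      ((1 - η / (1 - η))⁻¹ : ℝ≥0) ^ d * ENNReal.ofReal
          ((2 * 2) ^ d * r ^ (t : ℝ) / singularValueFunction t (moranLinear T k (u.take k))) *
        volume (Metric.closedBall (0 : Fin τ → EuclideanSpace ℝ (Fin d)) (ρ + 1)) := by
  have hη1 : η < 1 := hη2.trans (by norm_num)
  have hδ : η / (1 - η) < 1 := by
    rw [div_lt_one (tsub_pos_of_lt hη1), lt_tsub_iff_right, ← two_mul]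
    exact (mul_lt_mul_of_pos_left hη2 two_pos).trans_eq (mul_inv_cancel₀ two_ne_zero)
  obtain ⟨G, hG, hGnear⟩ := exists_continuousLinearMap_codingTail_sub hη1 hη γ k u v
  have hpq : γ k (u.take k) (u k) ≠ γ k (v.take k) (v k) := huv ▸ (hγ k _).ne hne
  obtain ⟨ι, hι, hιsub⟩ :=
    exists_continuousLinearMap_apply_sub_apply (E := EuclideanSpace ℝ (Fin d)) hpq
  have hdiff : ∀ a, codingMap T (translations γ a) u - codingMap T (translations γ a) v =
      moranLinear T k (u.take k) (G a) := fun a => by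
    rw [hG, codingMap_sub_codingMap hη1 hη (fun _ _ _ => norm_le_pi_norm a _) huv]
  have hGι : ‖G.comp ι - ContinuousLinearMap.id ℝ _‖ ≤ (η / (1 - η) : ℝ≥0) := by
    refine ContinuousLinearMap.opNorm_le_bound _ (NNReal.coe_nonneg _) fun y => ?_
    have hnear := hGnear (ι y)
    rw [hιsub] at hnear
    have hη' : (0 : ℝ) < 1 - η := sub_pos.2 hη1
    calc ‖G (ι y) - y‖ ≤ 2 * (η * ((1 - η : ℝ)⁻¹ * ‖ι y‖)) := hnear
      _ ≤ 2 * (η * ((1 - η : ℝ)⁻¹ * (2⁻¹ * ‖y‖))) := by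
        gcongr
        exact ι.le_of_opNorm_le hι y
      _ = (η / (1 - η) : ℝ≥0) * ‖y‖ := by
        rw [NNReal.coe_div, NNReal.coe_sub hη1.le, NNReal.coe_one]
        ring
  simp only [hdiff]
  exact volume_mul_measure_norm_comp_le_le volume (hι.trans (by norm_num)) hδ hGι
    (moranLinear_injective hT k _) ht hr ρ

end Transversality

section Correlation

variable {X : Type*} [PseudoMetricSpace X] [SecondCountableTopology X] [MeasurableSpace X]
  [OpensMeasurableSpace X]

/-- The correlation integral of `ν` at scale `r`: the `ν ⊗ ν`-measure of the pairs of points at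
distance at most `r`. -/
def correlation (ν : Measure X) (r : ℝ) : ℝ≥0∞ := ∫⁻ x, ν (Metric.closedBall x r) ∂ν

theorem measurable_measure_closedBall (ν : Measure X) [SFinite ν] (r : ℝ) :
    Measurable fun x => ν (Metric.closedBall x r) := by
  have hm : MeasurableSet {p : X × X | dist p.2 p.1 ≤ r} :=
    measurableSet_le (measurable_snd.dist measurable_fst) measurable_const
  exact measurable_measure_prodMk_left hm

theorem lintegral_measure_closedBall_div (ν : Measure X) [SFinite ν] (r : ℝ) (c : ℝ≥0∞) :
    ∫⁻ x, ν (Metric.closedBall x r) / c ∂ν = correlation ν r / c :=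
  lintegral_mul_const _ (measurable_measure_closedBall ν r)

theorem correlation_map {Ω : Type*} [MeasurableSpace Ω] (μ : Measure Ω) [SFinite μ] {f : Ω → X}
    (hf : Measurable f) (r : ℝ) :
    correlation (μ.map f) r = (μ.prod μ) {p | dist (f p.1) (f p.2) ≤ r} := by
  have hm : MeasurableSet {p : Ω × Ω | dist (f p.1) (f p.2) ≤ r} :=
    measurableSet_le ((hf.comp measurable_fst).dist (hf.comp measurable_snd)) measurable_const
  rw [correlation, lintegral_map (measurable_measure_closedBall _ r) hf, Measure.prod_apply hm]
  refine lintegral_congr fun u => ?_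
  rw [Measure.map_apply hf Metric.isClosed_closedBall.measurableSet]
  simp only [Set.preimage, Metric.mem_closedBall, Set.mem_ofPred_eq, dist_comm]

section Family

variable {Λ Ω : Type*} [MeasurableSpace Λ] [MeasurableSpace Ω] {f : Λ → Ω → X}

theorem measurableSet_dist_family_le (hf : Measurable (Function.uncurry f)) (r : ℝ) :
    MeasurableSet {q : Λ × Ω × Ω | dist (f q.1 q.2.1) (f q.1 q.2.2) ≤ r} :=
  measurableSet_le ((hf.comp (measurable_fst.prodMk (measurable_fst.comp measurable_snd))).dist
    (hf.comp (measurable_fst.prodMk (measurable_snd.comp measurable_snd)))) measurable_const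

variable (μ : Measure Ω) [SFinite μ]

theorem measurable_correlation_map (hf : Measurable (Function.uncurry f)) (r : ℝ) :
    Measurable fun a => correlation (μ.map (f a)) r := by
  simp only [fun a => correlation_map μ (hf.of_uncurry_left (x := a)) r]
  exact measurable_measure_prodMk_left (measurableSet_dist_family_le hf r)

theorem lintegral_correlation_map (hf : Measurable (Function.uncurry f)) (r : ℝ) (ℓ : Measure Λ)
    [SFinite ℓ] :
    ∫⁻ a, correlation (μ.map (f a)) r ∂ℓ =
      ∫⁻ p, ℓ {a | dist (f a p.1) (f a p.2) ≤ r} ∂(μ.prod μ) := by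
  have hQ := measurableSet_dist_family_le hf r
  simp only [fun a => correlation_map μ (hf.of_uncurry_left (x := a)) r]
  exact (Measure.prod_apply hQ).symm.trans (Measure.prod_apply_symm hQ)

end Family

end Correlation

section MassDistribution

theorem exists_measure_setOf_le_natCast_ne_zero {X : Type*} [MeasurableSpace X] {ν : Measure X}
    [NeZero ν] {F : X → ℝ≥0∞} (hF : ∀ᵐ x ∂ν, F x < ∞) : ∃ M : ℕ, ν {x | F x ≤ M} ≠ 0 := by
  by_contra! hzero
  have hnotMem : ∀ᵐ x ∂ν, x ∉ ⋃ M : ℕ, {x | F x ≤ M} :=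
    measure_eq_zero_iff_ae_notMem.1 (measure_iUnion_null hzero)
  obtain ⟨x, hx, hxM⟩ := (hF.and hnotMem).exists
  obtain ⟨M, hM⟩ := ENNReal.exists_nat_gt hx.ne
  exact hxM (Set.mem_iUnion.2 ⟨M, hM.le⟩)

variable {X : Type*} [MetricSpace X] [MeasurableSpace X] {ν : Measure X} {S : Set X}
  {t : ℝ} {K : ℝ≥0∞}

theorem measure_inter_le_mul_ediam_rpow (ht : 0 < t) (hK : K ≠ ∞)
    (hS : ∀ x ∈ S, ∀ N : ℕ, ν (Metric.closedBall x (2⁻¹ ^ N)) ≤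
      K * ENNReal.ofReal ((2⁻¹ ^ N) ^ t)) {s : Set X} (hs : Metric.ediam s ≤ 1) :
    ν (s ∩ S) ≤ K * ENNReal.ofReal (2 ^ t) * Metric.ediam s ^ t := by
  rcases (s ∩ S).eq_empty_or_nonempty with hempty | ⟨x, hxs, hxS⟩
  · simp only [hempty, measure_empty, zero_le]
  have hle : ∀ N : ℕ, Metric.ediam s ≤ ENNReal.ofReal (2⁻¹ ^ N) →
      ν (s ∩ S) ≤ K * ENNReal.ofReal ((2⁻¹ ^ N) ^ t) := fun N hN => by
    refine (measure_mono fun y hy => ?_).trans (hS x hxS N)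
    rw [Metric.mem_closedBall, ← ENNReal.ofReal_le_ofReal_iff (by positivity), ← edist_dist]
    exact (Metric.edist_le_ediam_of_mem hy.1 hxs).trans hN
  lift Metric.ediam s to ℝ≥0 using (hs.trans_lt ENNReal.one_lt_top).ne with δ hδ
  rcases eq_or_ne δ 0 with rfl | hδ0
  · have hlim : Tendsto (fun N : ℕ => K * ENNReal.ofReal ((2⁻¹ ^ N) ^ t)) atTop (𝓝 0) := by
      have hpow : Tendsto (fun N : ℕ => ((2⁻¹ : ℝ) ^ N) ^ t) atTop (𝓝 (0 ^ t)) :=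
        (tendsto_pow_atTop_nhds_zero_of_lt_one (by norm_num) (by norm_num)).rpow_const
          (Or.inr ht.le)
      rw [Real.zero_rpow ht.ne'] at hpow
      simpa only [ENNReal.ofReal_zero, mul_zero] using
        ENNReal.Tendsto.const_mul (a := K) (ENNReal.tendsto_ofReal hpow) (Or.inr hK)
    exact (ge_of_tendsto' hlim fun N => hle N zero_le).trans zero_le
  · obtain ⟨N, hN1, hN2⟩ := exists_nat_pow_near_of_lt_one
      (pos_iff_ne_zero.2 hδ0) (ENNReal.coe_le_one_iff.1 hs) (y := (2⁻¹ : ℝ≥0)) (by norm_num)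
      (by norm_num)
    have hN : (2⁻¹ ^ N : ℝ) ≤ 2 * δ := by
      have : (2⁻¹ ^ (N + 1) : ℝ) < δ := by exact_mod_cast hN1
      rw [pow_succ] at this
      linarith
    have hδN : (δ : ℝ≥0∞) ≤ ENNReal.ofReal (2⁻¹ ^ N) :=
      ENNReal.coe_le_coe.2 (NNReal.le_toNNReal_of_coe_le (by exact_mod_cast hN2))
    calc ν (s ∩ S) ≤ K * ENNReal.ofReal ((2⁻¹ ^ N) ^ t) := hle N hδN
      _ ≤ K * ENNReal.ofReal ((2 * δ) ^ t) := by gcongr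
      _ = K * ENNReal.ofReal (2 ^ t) * (δ : ℝ≥0∞) ^ t := by
        rw [Real.mul_rpow zero_le_two δ.coe_nonneg, ENNReal.ofReal_mul (by positivity), ← mul_assoc,
          ← ENNReal.ofReal_rpow_of_nonneg δ.coe_nonneg ht.le, ENNReal.ofReal_coe_nnreal]

variable [BorelSpace X]

theorem measure_inter_le_mul_hausdorffMeasure (hSm : MeasurableSet S) (ht : 0 < t) (hK0 : K ≠ 0)
    (hK : K ≠ ∞) (hS : ∀ x ∈ S, ∀ N : ℕ, ν (Metric.closedBall x (2⁻¹ ^ N)) ≤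
      K * ENNReal.ofReal ((2⁻¹ ^ N) ^ t)) (A : Set X) :
    ν (A ∩ S) ≤ K * ENNReal.ofReal (2 ^ t) * μH[t] A := by
  set c := K * ENNReal.ofReal (2 ^ t)
  have hc0 : c ≠ 0 := mul_ne_zero hK0 (ENNReal.ofReal_pos.2 (by positivity)).ne'
  have hc : c ≠ ∞ := ENNReal.mul_ne_top hK ENNReal.ofReal_ne_top
  have hle : c⁻¹ • ν.restrict S ≤ μH[t] := by
    refine Measure.le_hausdorffMeasure t _ 1 one_pos fun s hs => ?_
    rw [Measure.smul_apply, smul_eq_mul, Measure.restrict_apply' hSm, mul_comm, ← div_eq_mul_inv]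
    exact ENNReal.div_le_of_le_mul' (measure_inter_le_mul_ediam_rpow ht hK hS hs)
  have hA := Measure.le_iff'.1 hle A
  rwa [Measure.smul_apply, smul_eq_mul, Measure.restrict_apply' hSm, mul_comm, ← div_eq_mul_inv,
    ENNReal.div_le_iff hc0 hc, mul_comm] at hA

theorem hausdorffMeasure_ne_zero_of_tsum_correlation [SecondCountableTopology X] [NeZero ν]
    [SFinite ν] {A : Set X} (hνA : ∀ᵐ x ∂ν, x ∈ A) (ht : 0 < t)
    (h : ∑' N : ℕ, correlation ν (2⁻¹ ^ N) / ENNReal.ofReal ((2⁻¹ ^ N) ^ t) ≠ ∞) :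
    μH[t] A ≠ 0 := by
  set F : X → ℝ≥0∞ := fun x =>
    ∑' N : ℕ, ν (Metric.closedBall x (2⁻¹ ^ N)) / ENNReal.ofReal ((2⁻¹ ^ N) ^ t)
  have hm (N : ℕ) := (measurable_measure_closedBall ν (2⁻¹ ^ N)).div_const
    (ENNReal.ofReal ((2⁻¹ ^ N) ^ t))
  have hF : ∫⁻ x, F x ∂ν ≠ ∞ := by
    rwa [lintegral_tsum fun N => (hm N).aemeasurable,
      tsum_congr fun N => lintegral_measure_closedBall_div ν _ _]
  have hFm : Measurable F := .tsum hm
  obtain ⟨M, hM⟩ := exists_measure_setOf_le_natCast_ne_zero (ae_lt_top hFm hF)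
  have hball : ∀ x ∈ {x | F x ≤ M}, ∀ N : ℕ, ν (Metric.closedBall x (2⁻¹ ^ N)) ≤
      (M + 1) * ENNReal.ofReal ((2⁻¹ ^ N) ^ t) := fun x hx N => by
    have hN : ν (Metric.closedBall x (2⁻¹ ^ N)) / ENNReal.ofReal ((2⁻¹ ^ N) ^ t) ≤ M + 1 :=
      (ENNReal.le_tsum N).trans (le_trans hx le_self_add)
    rwa [ENNReal.div_le_iff (ENNReal.ofReal_pos.2 (by positivity)).ne' ENNReal.ofReal_ne_top] at hN
  intro hzero
  have hle := measure_inter_le_mul_hausdorffMeasure (measurableSet_le hFm measurable_const) ht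
    (by simp) (by simp) hball A
  rw [hzero, mul_zero, nonpos_iff_eq_zero] at hle
  have hae : (A ∩ {x | F x ≤ M} : Set X) =ᵐ[ν] {x | F x ≤ M} :=
    inter_ae_eq_right_of_ae_eq_univ (eventuallyEq_univ.2 hνA)
  exact hM ((measure_congr hae).symm.trans hle)

end MassDistribution

section PositiveMeasure

theorem ae_tendsto_measure_closedBall_div_of_mutuallySingular {X : Type*} [MetricSpace X]
    [SecondCountableTopology X] [HasBesicovitchCovering X] [MeasurableSpace X] [BorelSpace X]
    {μ ν : Measure X} [IsLocallyFiniteMeasure μ] [IsLocallyFiniteMeasure ν] (h : μ ⟂ₘ ν) :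
    ∀ᵐ x ∂ν, Tendsto (fun r => μ (Metric.closedBall x r) / ν (Metric.closedBall x r))
      (𝓝[>] 0) (𝓝 0) := by
  filter_upwards [Besicovitch.ae_tendsto_rnDeriv μ ν, h.rnDeriv_ae_eq_zero] with x hx h0
  rwa [h0] at hx

variable {V : Type*} [NormedAddCommGroup V] [NormedSpace ℝ V] [FiniteDimensional ℝ V]
  [MeasurableSpace V] [BorelSpace V] {μ ν : Measure V} [μ.IsAddHaarMeasure] [IsFiniteMeasure ν]

open Module in
theorem ae_tendsto_measure_closedBall_div_pow_of_mutuallySingular (h : μ ⟂ₘ ν) :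
    ∀ᵐ x ∂ν, Tendsto (fun r => ν (Metric.closedBall x r) / ENNReal.ofReal (r ^ finrank ℝ V))
      (𝓝[>] 0) (𝓝 ∞) := by
  set c := μ (Metric.ball 0 1)
  have hc0 : c ≠ 0 := (Metric.measure_ball_pos _ _ one_pos).ne'
  have hc : c ≠ ∞ := measure_ball_lt_top.ne
  filter_upwards [ae_tendsto_measure_closedBall_div_of_mutuallySingular h] with x hx
  have hlim := ENNReal.Tendsto.const_mul (a := c) (tendsto_inv_iff.2 hx) (Or.inl (by simp))
  rw [ENNReal.inv_zero, ENNReal.mul_top hc0] at hlim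
  refine hlim.congr' (eventually_mem_nhdsWithin.mono fun r hr => ?_)
  have hr0 : ENNReal.ofReal (r ^ finrank ℝ V) ≠ 0 := (ENNReal.ofReal_pos.2 (pow_pos hr _)).ne'
  rw [μ.addHaar_closedBall x (le_of_lt hr),
    ENNReal.inv_div (Or.inl (measure_ne_top _ _)) (Or.inr (mul_ne_zero hr0 hc0)), mul_comm _ c,
    ← mul_div_assoc, ENNReal.mul_div_mul_left _ _ hc0 hc]

open Module in
theorem measure_pos_of_liminf_correlation [NeZero ν] {A : Set V} (hνA : ∀ᵐ x ∂ν, x ∈ A)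
    {r : ℕ → ℝ} (hr : Tendsto r atTop (𝓝[>] 0))
    (h : liminf (fun N => correlation ν (r N) / ENNReal.ofReal (r N ^ finrank ℝ V)) atTop ≠ ∞) :
    0 < μ A := by
  refine pos_iff_ne_zero.2 fun hzero => h (top_unique ?_)
  have hsing : μ ⟂ₘ ν := .mk hzero (t := Aᶜ) hνA (by simp)
  have hliminf : ∀ᵐ x ∂ν, liminf (fun N => ν (Metric.closedBall x (r N)) /
      ENNReal.ofReal (r N ^ finrank ℝ V)) atTop = ∞ := by
    filter_upwards [ae_tendsto_measure_closedBall_div_pow_of_mutuallySingular hsing] with x hx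
    exact (hx.comp hr).liminf_eq
  calc ∞ = ∫⁻ x, liminf (fun N => ν (Metric.closedBall x (r N)) /
        ENNReal.ofReal (r N ^ finrank ℝ V)) atTop ∂ν := by
        rw [lintegral_congr_ae hliminf, lintegral_const, ENNReal.top_mul (NeZero.ne _)]
    _ ≤ liminf (fun N => ∫⁻ x, ν (Metric.closedBall x (r N)) /
        ENNReal.ofReal (r N ^ finrank ℝ V) ∂ν) atTop :=
      lintegral_liminf_le fun N => (measurable_measure_closedBall ν _).div_const _
    _ = _ := by simp only [lintegral_measure_closedBall_div]

end PositiveMeasure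

section CommonPrefixSum

variable {n : ℕ → ℕ} {κ : ∀ k, MoranWord n k → ℝ≥0∞}

/-- The sum of the weights `κ k v` of all the common prefixes `v` of the words `p.1` and `p.2`: a
kernel on pairs of infinite words, to be integrated against a product measure. -/
def commonPrefixSum (κ : ∀ k, MoranWord n k → ℝ≥0∞) (p : MoranInfWord n × MoranInfWord n) : ℝ≥0∞ :=
  ∑' k, ∑ v : MoranWord n k, (v.cylinder ×ˢ v.cylinder).indicator (fun _ => κ k v) p

theorem sum_le_commonPrefixSum {u v : MoranInfWord n} {k : ℕ} (h : u.take k = v.take k) :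
    κ k (u.take k) ≤ ∑ x : MoranWord n k, (x.cylinder ×ˢ x.cylinder).indicator
      (fun _ => κ k x) (u, v) := by
  have hmem : (u, v) ∈ (u.take k).cylinder ×ˢ (u.take k).cylinder :=
    ⟨(MoranWord.mem_cylinder_iff _ _).2 rfl, (MoranWord.mem_cylinder_iff _ _).2 h.symm⟩
  rw [← Set.indicator_of_mem hmem fun _ => κ k (u.take k)]
  exact Finset.single_le_sum (f := fun x : MoranWord n k =>
    (x.cylinder ×ˢ x.cylinder).indicator (fun _ => κ k x) (u, v)) (fun _ _ => zero_le)
    (Finset.mem_univ _)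

theorem le_commonPrefixSum {u v : MoranInfWord n} {k : ℕ} (h : u.take k = v.take k) :
    κ k (u.take k) ≤ commonPrefixSum κ (u, v) :=
  (sum_le_commonPrefixSum h).trans (ENNReal.le_tsum k)

theorem commonPrefixSum_self_eq_top {c : ℝ≥0∞} (hc : c ≠ 0) (hκ : ∀ k v, c ≤ κ k v)
    (u : MoranInfWord n) : commonPrefixSum κ (u, u) = ∞ :=
  top_unique <| (ENNReal.tsum_const_eq_top_of_ne_zero (α := ℕ) hc).ge.trans <|
    ENNReal.tsum_le_tsum fun k => (hκ k _).trans (sum_le_commonPrefixSum rfl)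

variable (μ : Measure (MoranInfWord n))

theorem sum_measure_cylinder (k : ℕ) : ∑ v : MoranWord n k, μ v.cylinder = μ Set.univ := by
  have hpre (v : MoranWord n k) :
      v.cylinder = (fun u : MoranInfWord n => u.take k) ⁻¹' {v} :=
    Set.ext fun u => v.mem_cylinder_iff u
  simp only [hpre]
  rw [sum_measure_preimage_singleton _ fun v _ =>
    MoranInfWord.measurable_take k (measurableSet_singleton v), Finset.coe_univ, Set.preimage_univ]

theorem lintegral_commonPrefixSum [SFinite μ] :
    ∫⁻ p, commonPrefixSum κ p ∂(μ.prod μ) =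
      ∑' k, ∑ v : MoranWord n k, κ k v * (μ v.cylinder * μ v.cylinder) := by
  have hcyl (k : ℕ) (v : MoranWord n k) := v.measurableSet_cylinder.prod v.measurableSet_cylinder
  have hm (k : ℕ) (v : MoranWord n k) :
      Measurable ((v.cylinder ×ˢ v.cylinder).indicator fun _ => κ k v) :=
    measurable_const.indicator (hcyl k v)
  simp only [commonPrefixSum]
  rw [lintegral_tsum fun k => (Finset.measurable_fun_sum _ fun v _ => hm k v).aemeasurable]
  refine tsum_congr fun k => ?_
  rw [lintegral_finsetSum _ fun v _ => hm k v]
  refine Finset.sum_congr rfl fun v _ => ?_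
  rw [lintegral_indicator_const (hcyl k v), Measure.prod_prod]

theorem lintegral_commonPrefixSum_le [IsProbabilityMeasure μ] {b : ℕ → ℝ≥0∞}
    (hb : ∀ k (v : MoranWord n k), κ k v * μ v.cylinder ≤ b k) :
    ∫⁻ p, commonPrefixSum κ p ∂(μ.prod μ) ≤ ∑' k, b k := by
  rw [lintegral_commonPrefixSum]
  refine ENNReal.tsum_le_tsum fun k => ?_
  calc ∑ v : MoranWord n k, κ k v * (μ v.cylinder * μ v.cylinder)
      ≤ ∑ v : MoranWord n k, b k * μ v.cylinder := Finset.sum_le_sum fun v _ => by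
        rw [← mul_assoc]
        gcongr
        exact hb k v
    _ = b k := by rw [← Finset.mul_sum, sum_measure_cylinder, measure_univ, mul_one]

end CommonPrefixSum

section MeanCorrelation

variable {d : ℕ} {n : ℕ → ℕ}
  {T : ∀ k, Fin (n k) → (EuclideanSpace ℝ (Fin d) →L[ℝ] EuclideanSpace ℝ (Fin d))}
  {η : ℝ≥0} {τ : ℕ} {γ : ∀ k, MoranWord n k → Fin (n k) → Fin τ}

theorem exists_volume_norm_codingMap_sub_le (hη2 : η < 2⁻¹) (hη : ∀ k j, ‖T k j‖ ≤ η)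
    (hT : ∀ k j, Function.Injective (T k j)) (hγ : ∀ k u, Function.Injective (γ k u)) {t : ℝ≥0}
    (ht : t ≤ d) (ρ : ℝ) :
    ∃ C : ℝ≥0∞, C ≠ ∞ ∧ ∀ r : ℝ, 0 < r → ∀ (k : ℕ) (u v : MoranInfWord n),
      u.take k = v.take k → u k ≠ v k →
      volume (Metric.closedBall (0 : Fin τ → EuclideanSpace ℝ (Fin d)) ρ ∩
          {a | ‖codingMap T (translations γ a) u - codingMap T (translations γ a) v‖ ≤ r}) ≤
        C * ENNReal.ofReal
          (r ^ (t : ℝ) / singularValueFunction t (moranLinear T k (u.take k))) := by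
  set c := volume (Metric.closedBall (0 : EuclideanSpace ℝ (Fin d)) 1)
  have hc0 : c ≠ 0 := (Metric.measure_closedBall_pos _ _ one_pos).ne'
  have hc : c ≠ ∞ := measure_closedBall_lt_top.ne
  refine ⟨((1 - η / (1 - η))⁻¹ : ℝ≥0) ^ d * ENNReal.ofReal ((2 * 2) ^ d) *
      volume (Metric.closedBall (0 : Fin τ → EuclideanSpace ℝ (Fin d)) (ρ + 1)) / c,
    (ENNReal.div_lt_top (ENNReal.mul_ne_top (by finiteness) measure_closedBall_lt_top.ne) hc0).ne,
    fun r hr k u v huv hne => ?_⟩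
  rw [← ENNReal.mul_div_right_comm, ENNReal.le_div_iff_mul_le (Or.inl hc0) (Or.inl hc), mul_comm]
  refine (volume_norm_codingMap_sub_le hη2 hη hT hγ ht hr ρ huv hne).trans_eq ?_
  rw [mul_div_assoc, ENNReal.ofReal_mul (by positivity)]
  ring

theorem exists_volume_dist_codingMap_le_commonPrefixSum (hη2 : η < 2⁻¹) (hη : ∀ k j, ‖T k j‖ ≤ η)
    (hT : ∀ k j, Function.Injective (T k j)) (hγ : ∀ k u, Function.Injective (γ k u)) {t : ℝ≥0}
    (ht : t ≤ d) (ρ : ℝ) :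
    ∃ C : ℝ≥0∞, C ≠ ∞ ∧ ∀ r : ℝ, 0 < r → ∀ p : MoranInfWord n × MoranInfWord n,
      volume.restrict (Metric.closedBall (0 : Fin τ → EuclideanSpace ℝ (Fin d)) ρ)
          {a | dist (codingMap T (translations γ a) p.1) (codingMap T (translations γ a) p.2) ≤ r} ≤
        commonPrefixSum (fun k v => C * ENNReal.ofReal
          (r ^ (t : ℝ) / singularValueFunction t (moranLinear T k v))) p := by
  obtain ⟨C, hC, hle⟩ := exists_volume_norm_codingMap_sub_le hη2 hη hT hγ ht ρ
  refine ⟨C + 1, by finiteness, fun r hr ⟨u, v⟩ => ?_⟩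
  have hrt : 0 < r ^ (t : ℝ) := Real.rpow_pos_of_pos hr _
  rcases eq_or_ne u v with rfl | huv
  · have hlower (k : ℕ) (v : MoranWord n k) : (C + 1) * ENNReal.ofReal (r ^ (t : ℝ)) ≤
        (C + 1) * ENNReal.ofReal (r ^ (t : ℝ) / singularValueFunction t (moranLinear T k v)) := by
      gcongr
      have hT1 : ‖moranLinear T k v‖ ≤ 1 := (norm_moranLinear_le hη k v).trans
        (pow_le_one₀ η.coe_nonneg (by exact_mod_cast hη2.le.trans (by norm_num)))
      exact le_div_self hrt.le (singularValueFunction_pos (moranLinear_injective hT k v))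
        (singularValueFunction_le_one (moranLinear_injective hT k v) hT1 ht)
    rw [commonPrefixSum_self_eq_top
      (mul_ne_zero (by simp) (ENNReal.ofReal_pos.2 hrt).ne') hlower]
    exact le_top
  · classical
    have hex : ∃ k, u k ≠ v k := Function.ne_iff.1 huv
    have htake : u.take (Nat.find hex) = v.take (Nat.find hex) := funext fun i =>
      not_not.1 (Nat.find_min hex i.2)
    refine le_trans ?_ (le_commonPrefixSum htake)
    rw [Measure.restrict_apply' Metric.isClosed_closedBall.measurableSet, Set.inter_comm]
    simp only [dist_eq_norm]
    exact (hle r hr _ u v htake (Nat.find_spec hex)).trans (by gcongr; exact le_self_add)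

theorem singularValueFunction_moranLinear_le (hd : 0 < d) (hη : ∀ k j, ‖T k j‖ ≤ η)
    (hT : ∀ k j, Function.Injective (T k j)) {s t : ℝ≥0} (ht : t ≤ d) (hts : t ≤ s) (k : ℕ)
    (u : MoranWord n k) :
    singularValueFunction s (moranLinear T k u) ≤
      (η ^ ((s : ℝ) - t)) ^ k * singularValueFunction t (moranLinear T k u) := by
  have hTu := moranLinear_injective hT k u
  refine (singularValueFunction_le_rpow_mul hd hTu ht hts).trans
    (mul_le_mul_of_nonneg_right ?_ (singularValueFunction_pos hTu).le)
  rw [Real.rpow_pow_comm η.coe_nonneg]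
  exact Real.rpow_le_rpow (norm_nonneg _) (norm_moranLinear_le hη k u) (by simpa using hts)

variable (γ) in
theorem exists_forall_lintegral_correlation_le (hd : 0 < d) (hn : ∀ k, 0 < n k) (hη2 : η < 2⁻¹)
    (hη : ∀ k j, ‖T k j‖ ≤ η) (hT : ∀ k j, Function.Injective (T k j))
    (hγ : ∀ k u, Function.Injective (γ k u)) {s t : ℝ≥0} (ht : t ≤ d) (hts : t < s)
    (hs : netMeasure T s Set.univ ≠ 0) :
    ∃ μ : Measure (MoranInfWord n), IsProbabilityMeasure μ ∧ ∀ ρ : ℝ, ∃ C : ℝ≥0∞, C ≠ ∞ ∧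
      ∀ r : ℝ, 0 < r →
        ∫⁻ a in Metric.closedBall (0 : Fin τ → EuclideanSpace ℝ (Fin d)) ρ,
          correlation (μ.map (codingMap T (translations γ a))) r ≤
        C * ENNReal.ofReal (r ^ (t : ℝ)) := by
  obtain ⟨μ, Cμ, hμ, hCμ, hcyl⟩ := exists_measure_cylinder_le_singularValueFunction hn hT hs
  have hη1 : η < 1 := hη2.trans (by norm_num)
  set θ := η ^ ((s : ℝ) - t)
  have hθ : θ < 1 := NNReal.rpow_lt_one hη1 (sub_pos.2 hts)
  have hsum : ∑' k, (θ : ℝ≥0∞) ^ k ≠ ∞ := by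
    rw [ENNReal.tsum_geometric]
    exact ENNReal.inv_ne_top.2 (tsub_pos_of_lt (by exact_mod_cast hθ)).ne'
  refine ⟨μ, hμ, fun ρ => ?_⟩
  obtain ⟨C, hC, hle⟩ := exists_volume_dist_codingMap_le_commonPrefixSum hη2 hη hT hγ ht ρ
  refine ⟨C * Cμ * ∑' k, (θ : ℝ≥0∞) ^ k, by finiteness, fun r hr => ?_⟩
  have hrt : 0 < r ^ (t : ℝ) := Real.rpow_pos_of_pos hr _
  rw [lintegral_correlation_map μ (measurable_codingMap hη1 hη)]
  refine (lintegral_mono (hle r hr)).trans ((lintegral_commonPrefixSum_le μ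
    (b := fun k => C * Cμ * ENNReal.ofReal (r ^ (t : ℝ)) * θ ^ k) fun k v => ?_).trans_eq ?_)
  · set φs := singularValueFunction s (moranLinear T k v)
    set φt := singularValueFunction t (moranLinear T k v)
    have hφt : 0 < φt := singularValueFunction_pos (moranLinear_injective hT k v)
    have hφ : φs ≤ θ ^ k * φt := singularValueFunction_moranLinear_le hd hη hT ht hts.le k v
    calc C * ENNReal.ofReal (r ^ (t : ℝ) / φt) * μ v.cylinder
        ≤ C * ENNReal.ofReal (r ^ (t : ℝ) / φt) * (Cμ * ENNReal.ofReal (θ ^ k * φt)) := by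
          gcongr
          exact (hcyl k v).trans (by gcongr)
      _ = C * Cμ * ENNReal.ofReal (r ^ (t : ℝ) * θ ^ k) := by
          rw [mul_mul_mul_comm, ← ENNReal.ofReal_mul (by positivity)]
          congr 2
          field_simp
      _ = C * Cμ * ENNReal.ofReal (r ^ (t : ℝ)) * θ ^ k := by
          rw [ENNReal.ofReal_mul hrt.le, ENNReal.ofReal_pow θ.coe_nonneg, ENNReal.ofReal_coe_nnreal,
            mul_assoc _ _ (_ ^ k)]
  · rw [ENNReal.tsum_mul_left]
    ring

end MeanCorrelation

section AlmostEverywhere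

variable {Λ : Type*} [MeasurableSpace Λ] {ℓ : Measure Λ} {g : ℝ → Λ → ℝ≥0∞} {C : ℝ≥0∞} {s : ℝ}

theorem ae_of_forall_ae_restrict_closedBall {V : Type*} [PseudoMetricSpace V] [MeasurableSpace V]
    {μ : Measure V} {P : V → Prop} (x : V)
    (h : ∀ ρ : ℕ, ∀ᵐ a ∂μ.restrict (Metric.closedBall x ρ), P a) : ∀ᵐ a ∂μ, P a := by
  rwa [← Measure.restrict_univ (μ := μ), ← Metric.iUnion_closedBall_nat x, ae_restrict_iUnion_iff]

theorem lintegral_div_ofReal_rpow_le (hg : ∀ r, Measurable (g r))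
    (h : ∀ r, 0 < r → ∫⁻ a, g r a ∂ℓ ≤ C * ENNReal.ofReal (r ^ s)) (t : ℝ) {r : ℝ} (hr : 0 < r) :
    ∫⁻ a, g r a / ENNReal.ofReal (r ^ t) ∂ℓ ≤ C * ENNReal.ofReal (r ^ (s - t)) := by
  simp only [div_eq_mul_inv]
  rw [lintegral_mul_const _ (hg r), ← div_eq_mul_inv]
  refine ENNReal.div_le_of_le_mul ((h r hr).trans_eq ?_)
  rw [mul_assoc, ← ENNReal.ofReal_mul (by positivity), ← Real.rpow_add hr, sub_add_cancel]

theorem ae_tsum_div_ofReal_rpow_ne_top (hg : ∀ r, Measurable (g r)) (hC : C ≠ ∞)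
    (h : ∀ r, 0 < r → ∫⁻ a, g r a ∂ℓ ≤ C * ENNReal.ofReal (r ^ s)) {t : ℝ} (hts : t < s) :
    ∀ᵐ a ∂ℓ, ∑' N : ℕ, g (2⁻¹ ^ N) a / ENNReal.ofReal ((2⁻¹ ^ N) ^ t) ≠ ∞ := by
  have hm (N : ℕ) := (hg (2⁻¹ ^ N)).div_const (ENNReal.ofReal ((2⁻¹ ^ N) ^ t))
  have hθ : (2⁻¹ : ℝ) ^ (s - t) < 1 :=
    Real.rpow_lt_one (by norm_num) (by norm_num) (sub_pos.2 hts)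
  have hint : ∫⁻ a, ∑' N : ℕ, g (2⁻¹ ^ N) a / ENNReal.ofReal ((2⁻¹ ^ N) ^ t) ∂ℓ ≠ ∞ := by
    refine ne_top_of_le_ne_top (b := C * ENNReal.ofReal (∑' N : ℕ, ((2⁻¹ : ℝ) ^ (s - t)) ^ N))
      (by finiteness) ?_
    rw [lintegral_tsum fun N => (hm N).aemeasurable, ENNReal.ofReal_tsum_of_nonneg
      (fun N => by positivity) (summable_geometric_of_lt_one (by positivity) hθ),
      ← ENNReal.tsum_mul_left]
    refine ENNReal.tsum_le_tsum fun N => ?_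
    rw [Real.rpow_pow_comm (by norm_num)]
    exact lintegral_div_ofReal_rpow_le hg h t (by positivity)
  exact (ae_lt_top (.tsum hm) hint).mono fun a ha => ha.ne

theorem ae_liminf_div_ofReal_rpow_ne_top (hg : ∀ r, Measurable (g r)) (hC : C ≠ ∞)
    (h : ∀ r, 0 < r → ∫⁻ a, g r a ∂ℓ ≤ C * ENNReal.ofReal (r ^ s)) {r : ℕ → ℝ}
    (hr : ∀ N, 0 < r N) :
    ∀ᵐ a ∂ℓ, liminf (fun N => g (r N) a / ENNReal.ofReal (r N ^ s)) atTop ≠ ∞ := by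
  have hm (N : ℕ) := (hg (r N)).div_const (ENNReal.ofReal (r N ^ s))
  have hle (N : ℕ) : ∫⁻ a, g (r N) a / ENNReal.ofReal (r N ^ s) ∂ℓ ≤ C := by
    simpa only [sub_self, Real.rpow_zero, ENNReal.ofReal_one, mul_one] using
      lintegral_div_ofReal_rpow_le hg h s (hr N)
  have hliminf : liminf (fun N => ∫⁻ a, g (r N) a / ENNReal.ofReal (r N ^ s) ∂ℓ) atTop ≤ C :=
    (liminf_le_liminf (Eventually.of_forall hle)).trans_eq (liminf_const C)
  exact (ae_lt_top (.liminf hm) (ne_top_of_le_ne_top hC ((lintegral_liminf_le hm).trans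
    hliminf))).mono fun a ha => ha.ne

end AlmostEverywhere

section AlmostAllParameters

variable {d : ℕ} {n : ℕ → ℕ}
  {T : ∀ k, Fin (n k) → (EuclideanSpace ℝ (Fin d) →L[ℝ] EuclideanSpace ℝ (Fin d))}
  {η : ℝ≥0} {τ : ℕ} {γ : ∀ k, MoranWord n k → Fin (n k) → Fin τ}

theorem isClosed_moranSet {w : ∀ k, MoranWord n k → Fin (n k) → EuclideanSpace ℝ (Fin d)}
    {J : Set (EuclideanSpace ℝ (Fin d))} (hJ : IsCompact J) : IsClosed (moranSet T w J) :=
  isClosed_iInter fun k => isClosed_iUnion_of_finite fun u =>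
    (isCompact_moranBasicSet hJ (k + 1) u).isClosed

theorem ae_map_codingMap_mem_moranSet (hη1 : η < 1) (hη : ∀ k j, ‖T k j‖ ≤ η)
    (μ : Measure (MoranInfWord n)) {a : Fin τ → EuclideanSpace ℝ (Fin d)}
    {J : Set (EuclideanSpace ℝ (Fin d))} (hJ : IsSelfAffineMoran T (translations γ a) J) :
    ∀ᵐ x ∂μ.map (codingMap T (translations γ a)), x ∈ moranSet T (translations γ a) J :=
  (ae_map_iff ((measurable_codingMap hη1 hη).of_uncurry_left (x := a)).aemeasurable
    (isClosed_moranSet hJ.isCompact).measurableSet).2 <| Eventually.of_forall fun u =>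
      codingMap_mem_moranSet hη1 hη (fun _ _ _ => norm_le_pi_norm a _) hJ u

theorem netMeasure_ne_zero_of_lt_criticalValue {s : ℝ≥0} (hs : s < criticalValue T) :
    netMeasure T s Set.univ ≠ 0 := fun h =>
  hs.not_ge (iInf₂_le s h)

theorem ae_le_dimH_moranSet (hd : 0 < d) (hn : ∀ k, 0 < n k) (hη2 : η < 2⁻¹)
    (hη : ∀ k j, ‖T k j‖ ≤ η) (hT : ∀ k j, Function.Injective (T k j))
    (hγ : ∀ k u, Function.Injective (γ k u)) {t : ℝ≥0} (ht : t < min (criticalValue T) d) :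
    ∀ᵐ a : Fin τ → EuclideanSpace ℝ (Fin d), ∀ J, IsSelfAffineMoran T (translations γ a) J →
      t ≤ dimH (moranSet T (translations γ a) J) := by
  rcases eq_zero_or_pos t with rfl | ht0
  · simp only [ENNReal.coe_zero, zero_le, implies_true, eventually_true]
  obtain ⟨t', htt', ht'⟩ := ENNReal.lt_iff_exists_nnreal_btwn.1 ht
  obtain ⟨s, ht's, hs⟩ := ENNReal.lt_iff_exists_nnreal_btwn.1 (lt_min_iff.1 ht').1
  have ht'd : t' ≤ d := by exact_mod_cast (lt_min_iff.1 ht').2.le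
  obtain ⟨μ, hμ, hcorr⟩ := exists_forall_lintegral_correlation_le γ hd hn hη2 hη hT hγ ht'd
    (ENNReal.coe_lt_coe.1 ht's) (netMeasure_ne_zero_of_lt_criticalValue hs)
  have hη1 : η < 1 := hη2.trans (by norm_num)
  have hf := measurable_codingMap (γ := γ) hη1 hη
  refine ae_of_forall_ae_restrict_closedBall 0 fun ρ => ?_
  obtain ⟨C, hC, hle⟩ := hcorr ρ
  filter_upwards [ae_tsum_div_ofReal_rpow_ne_top (measurable_correlation_map μ hf) hC hle
    (ENNReal.coe_lt_coe.1 htt')] with a ha J hJ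
  have := Measure.isProbabilityMeasure_map (μ := μ) (hf.of_uncurry_left (x := a)).aemeasurable
  exact le_dimH_of_hausdorffMeasure_ne_zero (hausdorffMeasure_ne_zero_of_tsum_correlation
    (ae_map_codingMap_mem_moranSet hη1 hη μ hJ) ht0 ha)

theorem ae_min_criticalValue_le_dimH_moranSet (hd : 0 < d) (hn : ∀ k, 0 < n k) (hη2 : η < 2⁻¹)
    (hη : ∀ k j, ‖T k j‖ ≤ η) (hT : ∀ k j, Function.Injective (T k j))
    (hγ : ∀ k u, Function.Injective (γ k u)) :
    ∀ᵐ a : Fin τ → EuclideanSpace ℝ (Fin d), ∀ J, IsSelfAffineMoran T (translations γ a) J →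
      min (criticalValue T) d ≤ dimH (moranSet T (translations γ a) J) := by
  have hae (q : {q : ℚ // (Real.toNNReal q : ℝ≥0∞) < min (criticalValue T) d}) :=
    ae_le_dimH_moranSet hd hn hη2 hη hT hγ q.2
  filter_upwards [ae_all_iff.2 hae] with a ha J hJ
  refine le_of_forall_lt fun b hb => ?_
  obtain ⟨q, -, hbq, hq⟩ := ENNReal.lt_iff_exists_rat_btwn.1 hb
  exact hbq.trans_le (ha ⟨q, hq⟩ J hJ)

theorem ae_volume_moranSet_pos (hd : 0 < d) (hn : ∀ k, 0 < n k) (hη2 : η < 2⁻¹)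
    (hη : ∀ k j, ‖T k j‖ ≤ η) (hT : ∀ k j, Function.Injective (T k j))
    (hγ : ∀ k u, Function.Injective (γ k u)) (hcrit : d < criticalValue T) :
    ∀ᵐ a : Fin τ → EuclideanSpace ℝ (Fin d), ∀ J, IsSelfAffineMoran T (translations γ a) J →
      0 < volume (moranSet T (translations γ a) J) := by
  obtain ⟨s, hds, hs⟩ := ENNReal.lt_iff_exists_nnreal_btwn.1 hcrit
  obtain ⟨μ, hμ, hcorr⟩ := exists_forall_lintegral_correlation_le γ hd hn hη2 hη hT hγ le_rfl
    (by exact_mod_cast hds) (netMeasure_ne_zero_of_lt_criticalValue hs)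
  have hη1 : η < 1 := hη2.trans (by norm_num)
  have hf := measurable_codingMap (γ := γ) hη1 hη
  have hr : Tendsto (fun N : ℕ => (2⁻¹ : ℝ) ^ N) atTop (𝓝[>] 0) := tendsto_nhdsWithin_iff.2
    ⟨tendsto_pow_atTop_nhds_zero_of_lt_one (by norm_num) (by norm_num),
      Eventually.of_forall fun N => Set.mem_Ioi.2 (by positivity)⟩
  refine ae_of_forall_ae_restrict_closedBall 0 fun ρ => ?_
  obtain ⟨C, hC, hle⟩ := hcorr ρ
  filter_upwards [ae_liminf_div_ofReal_rpow_ne_top (measurable_correlation_map μ hf) hC hle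
    (r := fun N => 2⁻¹ ^ N) fun N => by positivity] with a ha J hJ
  have := Measure.isProbabilityMeasure_map (μ := μ) (hf.of_uncurry_left (x := a)).aemeasurable
  refine measure_pos_of_liminf_correlation (ae_map_codingMap_mem_moranSet hη1 hη μ hJ) hr ?_
  simpa only [finrank_euclideanSpace_fin, NNReal.coe_natCast, Real.rpow_natCast] using ha

end AlmostAllParameters

end

theorem theorem2p4_general {d : ℕ} (hd : 0 < d) {n : ℕ → ℕ} (hn : ∀ k, 0 < n k)
    {T : ∀ k, Fin (n k) → (EuclideanSpace ℝ (Fin d) →L[ℝ] EuclideanSpace ℝ (Fin d))}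
    (hT : ∀ k j, Function.Injective (T k j))
    (hupper : ∃ η : ℝ, η < 1 / 2 ∧ ∀ k j, ‖T k j‖ ≤ η)
    {τ : ℕ} {γ : ∀ k, MoranWord n k → Fin (n k) → Fin τ}
    (hγ : ∀ k u, Function.Injective (γ k u)) :
    ∀ᵐ a : Fin τ → EuclideanSpace ℝ (Fin d) ∂volume,
      (∃ J, IsSelfAffineMoran T (fun k u j => a (γ k u j)) J) ∧
      ∀ J, IsSelfAffineMoran T (fun k u j => a (γ k u j)) J →
        dimH (moranSet T (fun k u j => a (γ k u j)) J) = min (criticalValue T) d ∧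
        (d < criticalValue T →
          0 < volume (moranSet T (fun k u j => a (γ k u j)) J)) := by
  obtain ⟨η, hη2, hη⟩ := hupper
  lift η to ℝ≥0 using (norm_nonneg _).trans (hη 0 ⟨0, hn 0⟩)
  have hη2' : η < 2⁻¹ := by rw [← NNReal.coe_lt_coe]; simpa using hη2
  have hη1 : η < 1 := hη2'.trans (by norm_num)
  have hpos : ∀ᵐ a : Fin τ → EuclideanSpace ℝ (Fin d), d < criticalValue T →
      ∀ J, IsSelfAffineMoran T (translations γ a) J →
        0 < volume (moranSet T (translations γ a) J) :=
    eventually_imp_distrib_left.2 fun hcrit => ae_volume_moranSet_pos hd hn hη2' hη hT hγ hcrit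
  filter_upwards [ae_min_criticalValue_le_dimH_moranSet hd hn hη2' hη hT hγ, hpos] with a hdim hvol
  refine ⟨exists_isSelfAffineMoran hη1 hη (norm_nonneg a) fun _ _ _ => norm_le_pi_norm a _,
    fun J hJ => ⟨le_antisymm (le_min (dimH_moranSet_le hn hT hη1 hη hJ) ?_) (hdim J hJ),
      fun hcrit => hvol hcrit J hJ⟩⟩
  exact (dimH_mono (Set.subset_univ _)).trans_eq
    (by rw [Real.dimH_univ_eq_finrank, finrank_euclideanSpace_fin])

theorem theorem2p4 (d : ℕ) (hd : 0 < d) (n : ℕ → ℕ) (hn : ∀ k, 2 ≤ n k)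
    (T : ∀ k, Fin (n k) → (EuclideanSpace ℝ (Fin d) →L[ℝ] EuclideanSpace ℝ (Fin d)))
    (hlower : ∃ c : ℝ, 0 < c ∧ ∀ k j, c ≤ (T k j).toLinearMap.singularValues (d - 1))
    (hupper : ∃ η : ℝ, η < 1 / 2 ∧ ∀ k j, ‖T k j‖ ≤ η)
    (τ : ℕ) (γ : ∀ k, MoranWord n k → Fin (n k) → Fin τ)
    (hγ : ∀ k u, Function.Injective (γ k u)) :
    ∀ᵐ a : Fin τ → EuclideanSpace ℝ (Fin d) ∂volume,
      (∃ J, IsSelfAffineMoran T (fun k u j => a (γ k u j)) J) ∧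
      ∀ J, IsSelfAffineMoran T (fun k u j => a (γ k u j)) J →
        (criticalValue T ≤ d →
          dimH (moranSet T (fun k u j => a (γ k u j)) J) = criticalValue T) ∧
        (d < criticalValue T →
          0 < volume (moranSet T (fun k u j => a (γ k u j)) J)) := by
  obtain ⟨c, hc, hσ⟩ := hlower
  have hT : ∀ k j, Function.Injective (T k j) := fun k j =>
    injective_of_singularValues_pos (hc.trans_le (hσ k j))
  filter_upwards [theorem2p4_general hd (fun k => two_pos.trans_le (hn k)) hT hupper hγ] with a ha
  exact ⟨ha.1, fun J hJ => ⟨fun h => (ha.2 J hJ).1.trans (min_eq_left h), (ha.2 J hJ).2⟩⟩
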